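/- Let $M$ be a connected smooth manifold with a smooth Riemannian metric $\alpha$, and let $\beta$ be a smooth one-form on $M$, not identically zero, whose dual vector field $\beta^\sharp$ (given by $\alpha(\beta^\sharp,X)=\beta(X)$) satisfies $|\beta^\sharp|<1$ everywhere. Let $F(v)=\sqrt{\alpha(v,v)}+\beta(v)$ be the associated (non-Riemannian) Randers metric. A linear connection $\nabla$ on $M$ is called compatible with $F$ if its parallel transports preserve the $F$-norm of tangent vectors; assume that $F$ is a generalized Berwald metric, i.e. that a compatible linear connection exists. Let $\nabla^*$ be the Lévi-Civita connection of $\alpha$ and put $$\nabla^\circ_XY=\nabla^*_XY+\frac{\alpha(\nabla^*_X\beta^\sharp,Y)}{|\beta^\sharp|^2}\,\beta^\sharp-\frac{\alpha(Y,\beta^\sharp)}{|\beta^\sharp|^2}\,\nabla^*_X\beta^\sharp .$$ (For such $F$ the length $|\beta^\sharp|$ is a non-zero constant.) Then there is exactly one extremal compatible linear connection, i.e. a compatible linear connection $\nabla$ whose torsion tensor $T$ satisfies $|T|_p\le|T'|_p$ at every point $p\in M$ for the torsion $T'$ of every compatible linear connection. (Here $|T|_p^2=\sum_{i,j}\alpha(T(e_i,e_j),T(e_i,e_j))$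 for an $\alpha$-orthonormal basis $e_1,\dots,e_n$ of $T_pM$.) This extremal connection is equal to $\nabla^\circ$ if and only if the distribution of vector fields $\alpha$-orthogonal to $\beta^\sharp$ is integrable, i.e. for all smooth vector fields $X,Y$ on $M$ with $\alpha(X,\beta^\sharp)=\alpha(Y,\beta^\sharp)=0$ one has $\alpha([X,Y],\beta^\sharp)=0$. -/

import Mathlib

open Bundle Set
open scoped Manifold ContDiff

noncomputable section

namespace Randers

variable {E : Type*} [NormedAddCommGroup E] [NormedSpace ℝ E]
  {M : Type*} [TopologicalSpace M] [ChartedSpace E M] [IsManifold 𝓘(ℝ, E) ∞ M]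

section Connections

/-- A linear connection on `M`, i.e. a covariant derivative on the tangent bundle.
The convention is that `D Y p (X p)` is `(∇_X Y)(p)`. -/
abbrev Connection (E : Type*) [NormedAddCommGroup E] [NormedSpace ℝ E]
    (M : Type*) [TopologicalSpace M] [ChartedSpace E M] [IsManifold 𝓘(ℝ, E) ∞ M] :=
  CovariantDerivative 𝓘(ℝ, E) E (fun x : M ↦ TangentSpace 𝓘(ℝ, E) x)

/-- Equality of connections: they have the same values on differentiable vector fields. (The values
of a covariant derivative on non-differentiable fields are meaningless, hence are disregarded.) -/
def SameConnection (D D' : Connection E M) : Prop :=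
  ∀ (x : M) (Y : Π y : M, TangentSpace 𝓘(ℝ, E) y), MDiffAt (T% Y) x → D Y x = D' Y x

/-- The vector field `V` along the curve `γ : [a, b] → M` is parallel with respect to `D`.
At each `t`, write `V s = ∑ᵢ vⁱ(s) eᵢ(γ s)` in the coordinate frame `(eᵢ)` of the chart at `γ t`,
whose coordinate vector `v(s)` is the second component of the trivialization of `TM`.
`FiberBundle.extend E (V t)` is the field `∑ᵢ vⁱ(t) eᵢ` with constant coordinates. So the condition
is `v'(t) + ∑ᵢ vⁱ(t) ∇_{γ'(t)} eᵢ = 0`, which is the equation of parallel fields. -/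
def IsParallelAlong (D : Connection E M) (γ : ℝ → M) (a b : ℝ)
    (V : Π t : ℝ, TangentSpace 𝓘(ℝ, E) (γ t)) : Prop :=
  ∀ t ∈ Icc a b,
    HasDerivWithinAt
      (fun s : ℝ ↦ (trivializationAt E (TangentSpace 𝓘(ℝ, E) : M → Type _) (γ t) ⟨γ s, V s⟩).2)
      (-(trivializationAt E (TangentSpace 𝓘(ℝ, E) : M → Type _) (γ t)
        ⟨γ t, D (FiberBundle.extend E (x := γ t) (V t)) (γ t)
          (mfderivWithin 𝓘(ℝ, ℝ) 𝓘(ℝ, E) γ (Icc a b) t (1 : ℝ))⟩).2)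
      (Icc a b) t

/-- `w` is the parallel translate of `v` along the curve `γ` from time `a` to time `b`. -/
def IsParallelTranslate (D : Connection E M) (γ : ℝ → M) (a b : ℝ)
    (v : TangentSpace 𝓘(ℝ, E) (γ a)) (w : TangentSpace 𝓘(ℝ, E) (γ b)) : Prop :=
  ∃ V : Π t : ℝ, TangentSpace 𝓘(ℝ, E) (γ t), IsParallelAlong D γ a b V ∧ V a = v ∧ V b = w

end Connections

variable [FiniteDimensional ℝ E] [RiemannianBundle (fun x : M ↦ TangentSpace 𝓘(ℝ, E) x)]

instance finiteDimensional_tangentSpace (x : M) : FiniteDimensional ℝ (TangentSpace 𝓘(ℝ, E) x) :=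
  inferInstanceAs (FiniteDimensional ℝ E)

/-- The Riemannian dual vector field `β♯` of the one-form `β`, given by `⟪β♯, v⟫ = β v`. -/
def sharp (β : Π x : M, TangentSpace 𝓘(ℝ, E) x →L[ℝ] ℝ) (x : M) : TangentSpace 𝓘(ℝ, E) x :=
  haveI : CompleteSpace (TangentSpace 𝓘(ℝ, E) x) := FiniteDimensional.complete ℝ _
  (InnerProductSpace.toDual ℝ (TangentSpace 𝓘(ℝ, E) x)).symm (β x)

theorem inner_sharp (β : Π x : M, TangentSpace 𝓘(ℝ, E) x →L[ℝ] ℝ) (x : M)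
    (v : TangentSpace 𝓘(ℝ, E) x) : inner ℝ (sharp β x) v = β x v := by
  have : CompleteSpace (TangentSpace 𝓘(ℝ, E) x) := FiniteDimensional.complete ℝ _
  exact InnerProductSpace.toDual_symm_apply

/-- The Randers function `F(v) = √α(v, v) + β(v)`. -/
def randersNorm (β : Π x : M, TangentSpace 𝓘(ℝ, E) x →L[ℝ] ℝ) (x : M)
    (v : TangentSpace 𝓘(ℝ, E) x) : ℝ :=
  √(inner ℝ v v) + β x v

/-- `α + β` is a Randers metric: `β` is a smooth one-form with `|β♯| < 1` everywhere. -/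
structure IsRandersMetric (β : Π x : M, TangentSpace 𝓘(ℝ, E) x →L[ℝ] ℝ) : Prop where
  smooth : ContMDiff 𝓘(ℝ, E) (𝓘(ℝ, E).prod 𝓘(ℝ, E →L[ℝ] ℝ)) ∞
    (fun x ↦ TotalSpace.mk' (E →L[ℝ] ℝ)
      (E := fun x : M ↦ TangentSpace 𝓘(ℝ, E) x →L[ℝ] Trivial M ℝ x) x (β x))
  norm_sharp_lt_one : ∀ x, ‖sharp β x‖ < 1

/-- A (smooth) linear connection is compatible with the Randers metric if its parallel transports
along smooth curves preserve the Randers norm of tangent vectors. -/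
structure IsCompatible (β : Π x : M, TangentSpace 𝓘(ℝ, E) x →L[ℝ] ℝ) (D : Connection E M) :
    Prop where
  smooth : CovariantDerivative.ContMDiffCovariantDerivative D ∞
  preserves : ∀ (γ : ℝ → M) (a b : ℝ), a ≤ b → ContMDiffOn 𝓘(ℝ, ℝ) 𝓘(ℝ, E) ∞ γ (Icc a b) →
    ∀ (v : TangentSpace 𝓘(ℝ, E) (γ a)) (w : TangentSpace 𝓘(ℝ, E) (γ b)),
      IsParallelTranslate D γ a b v w → randersNorm β (γ b) w = randersNorm β (γ a) v

/-- A generalized Berwald Randers metric: a Randers metric admitting a compatible connection. -/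
structure IsGeneralizedBerwald (β : Π x : M, TangentSpace 𝓘(ℝ, E) x →L[ℝ] ℝ) : Prop where
  isRandersMetric : IsRandersMetric β
  exists_compatible : ∃ D : Connection E M, IsCompatible β D

/-- The squared norm of the torsion tensor at `x`: the sum of the squares of its components in an
orthonormal basis of the tangent space. -/
def torsionNormSq (D : Connection E M) (x : M) : ℝ :=
  ∑ i, ∑ j, ‖D.torsion x (stdOrthonormalBasis ℝ (TangentSpace 𝓘(ℝ, E) x) i)
    (stdOrthonormalBasis ℝ (TangentSpace 𝓘(ℝ, E) x) j)‖ ^ 2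

/-- An extremal compatible connection: a compatible connection whose torsion has, at each point,
the least norm among all compatible connections. -/
structure IsExtremal (β : Π x : M, TangentSpace 𝓘(ℝ, E) x →L[ℝ] ℝ) (D : Connection E M) :
    Prop where
  isCompatible : IsCompatible β D
  torsionNormSq_le : ∀ D' : Connection E M, IsCompatible β D' →
    ∀ x, torsionNormSq D x ≤ torsionNormSq D' x

/-- The Levi-Civita connection of `α`: the smooth torsion-free metric connection. -/
structure IsLeviCivita [IsContMDiffRiemannianBundle 𝓘(ℝ, E) ∞ E
    (fun x : M ↦ TangentSpace 𝓘(ℝ, E) x)] (D : Connection E M) : Prop where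
  smooth : CovariantDerivative.ContMDiffCovariantDerivative D ∞
  isMetricCompatible : @CovariantDerivative.IsMetricCompatible E _ _ E _ 𝓘(ℝ, E) M _ _ E _ _
    (fun x : M ↦ TangentSpace 𝓘(ℝ, E) x) _ (fun _ ↦ inferInstance) (fun _ ↦ inferInstance) _ D
    _ _ _ _
  torsion_eq_zero : D.torsion = 0

/-- The connection `∇°` built from a connection `∇*` (below the Levi-Civita connection):
`∇°_X Y = ∇*_X Y + (α(∇*_X β♯, Y) β♯ - α(Y, β♯) ∇*_X β♯) / |β♯|²`. -/
def nablaCirc (β : Π x : M, TangentSpace 𝓘(ℝ, E) x →L[ℝ] ℝ) (D : Connection E M) :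
    Connection E M where
  toFun Y x := D Y x + (‖sharp β x‖ ^ 2)⁻¹ •
    (((innerSL ℝ (Y x)).comp (D (sharp β) x)).smulRight (sharp β x)
      - (inner ℝ (Y x) (sharp β x) : ℝ) • D (sharp β) x)
  isCovariantDerivativeOnUniv :=
    { add := by
        intro Y Y' x hY hY' _
        ext v
        simp [D.isCovariantDerivativeOnUniv.add hY hY', inner_add_left]
        module
      leibniz := by
        intro Y g x hY hg _
        ext v
        simp [D.isCovariantDerivativeOnUniv.leibniz hY hg, inner_smul_left]
        module }

/-- The smooth vector fields that are `α`-orthogonal to `β♯` are closed under the Lie bracket. -/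
def OrthogonalDistributionIntegrable (β : Π x : M, TangentSpace 𝓘(ℝ, E) x →L[ℝ] ℝ) : Prop :=
  ∀ X Y : Π x : M, TangentSpace 𝓘(ℝ, E) x,
    ContMDiff 𝓘(ℝ, E) (𝓘(ℝ, E).prod 𝓘(ℝ, E)) ∞ (T% X) →
    ContMDiff 𝓘(ℝ, E) (𝓘(ℝ, E).prod 𝓘(ℝ, E)) ∞ (T% Y) →
    (∀ x, inner ℝ (X x) (sharp β x) = 0) → (∀ x, inner ℝ (Y x) (sharp β x) = 0) →
    ∀ x, inner ℝ (VectorField.mlieBracket 𝓘(ℝ, E) X Y x) (sharp β x) = 0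

end Randers

end

/-! If `V` is parallel, so is `-V`; hence a connection preserving `F` keeps the even part `|V|` and
the odd part `β(V)` of the norm constant separately. Differentiating at the start of short parallel
fields turns this into `∇α = 0` and `∇β♯ = 0` (`IsCompatible.isMetric`,
`IsCompatible.sharp_parallel`); the converse is `isCompatible_of_isMetricCompatible`. In particular
`|β♯|` is constant, and non-zero since `M` is connected and `β ≠ 0`.

Write `B = β♯` and `S = ∇*B`; constancy of `|B|` means that `S` takes values in `B^⊥`. Any two
compatible connections differ by a tensor `C` that is skew for the metric and kills `B`, so
minimising the torsion at a point is a least-squares problem over an affine space. Its solution is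
the connection whose torsion is orthogonal to the torsion of every such `C`. `extremalForm` gives it
explicitly: the term defining `∇°` plus `twistForm`, built from the skew part of `S` on `B^⊥`.
Orthogonality (`sum_norm_torsion_sq`) comes down to the vanishing trace of a symmetric operator
times a skew one. Pythagoras then gives minimality, and uniqueness follows because a skew `C`
without torsion is zero (`eq_zero_of_symm_of_antisymm`).

Thus the extremal connection is `∇°` iff the twist vanishes, i.e. iff `S` is symmetric on `B^⊥`. As
`⟨[X,Y],B⟩ = ⟨S Y,X⟩ - ⟨S X,Y⟩` for `X, Y ⟂ B`, this is integrability. -/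

noncomputable section

namespace Randers

open Filter Topology Module FiberBundle

variable {E : Type*} [NormedAddCommGroup E] [NormedSpace ℝ E]
  {M : Type*} [TopologicalSpace M] [ChartedSpace E M]

/-! ### Global smooth extensions of tangent vectors -/

section Extension

variable [IsManifold 𝓘(ℝ, E) ∞ M]

/-- A smooth vector field on `M`. -/
abbrev IsSmoothField (X : Π x : M, TangentSpace 𝓘(ℝ, E) x) : Prop :=
  ContMDiff 𝓘(ℝ, E) (𝓘(ℝ, E).prod 𝓘(ℝ, E)) ∞ (T% X)

theorem IsSmoothField.mdiffAt {X : Π x : M, TangentSpace 𝓘(ℝ, E) x} (hX : IsSmoothField X)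
    (x : M) : MDiffAt (T% X) x :=
  hX.mdifferentiableAt (by simp)

theorem contMDiffOn_extend {x : M} (v : TangentSpace 𝓘(ℝ, E) x) :
    ContMDiffOn 𝓘(ℝ, E) (𝓘(ℝ, E).prod 𝓘(ℝ, E)) ∞ (T% (extend E v))
      (trivializationAt E (TangentSpace 𝓘(ℝ, E) : M → Type _) x).baseSet := by
  rw [(trivializationAt E (TangentSpace 𝓘(ℝ, E) : M → Type _) x).contMDiffOn_section_baseSet_iff]
  refine (contMDiffOn_const
    (c := (trivializationAt E (TangentSpace 𝓘(ℝ, E) : M → Type _) x ⟨x, v⟩).2)).congr ?_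
  intro y hy
  simp only [extend]
  rw [Trivialization.apply_mk_symm _ hy]

/-- Every tangent vector extends to a global smooth vector field, which has constant coordinates
near the base point. -/
theorem exists_isSmoothField_eventuallyEq_extend [FiniteDimensional ℝ E] [T2Space M] {x : M}
    (v : TangentSpace 𝓘(ℝ, E) x) :
    ∃ X : Π y : M, TangentSpace 𝓘(ℝ, E) y, IsSmoothField X ∧
      ∀ᶠ y in 𝓝 x, X y = extend E v y := by
  let f : SmoothBumpFunction 𝓘(ℝ, E) x := Classical.arbitrary _
  refine ⟨(f : M → ℝ) • extend E v, ?_, ?_⟩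
  · have := ContMDiffOn.smul_section_of_tsupport (I := 𝓘(ℝ, E)) (n := ∞) (F := E)
      (V := (TangentSpace 𝓘(ℝ, E) : M → Type _)) (s := extend E v) (ψ := f)
      (u := (trivializationAt E (TangentSpace 𝓘(ℝ, E) : M → Type _) x).baseSet)
      f.contMDiff.contMDiffOn (Trivialization.open_baseSet _)
      (by simpa using f.tsupport_subset_chartAt_source) (contMDiffOn_extend v)
    exact this
  · filter_upwards [f.eventuallyEq_one] with y hy
    simp [hy]

theorem exists_isSmoothField_eq [FiniteDimensional ℝ E] [T2Space M] {x : M}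
    (v : TangentSpace 𝓘(ℝ, E) x) :
    ∃ X : Π y : M, TangentSpace 𝓘(ℝ, E) y, IsSmoothField X ∧ X x = v := by
  obtain ⟨X, hX, h⟩ := exists_isSmoothField_eventuallyEq_extend v
  exact ⟨X, hX, by simpa using h.self_of_nhds⟩

end Extension

/-! ### Smoothness of tensors and fields, tested on smooth vector fields -/

section SmoothnessTests

theorem contMDiffAt_of_forall_apply [FiniteDimensional ℝ E] {F : Type*} [NormedAddCommGroup F]
    [NormedSpace ℝ F] {G : Type*} [NormedAddCommGroup G] [NormedSpace ℝ G] [FiniteDimensional ℝ G]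
    {n : ℕ∞ω} {f : M → G →L[ℝ] F} {x : M}
    (h : ∀ v, ContMDiffAt 𝓘(ℝ, E) 𝓘(ℝ, F) n (fun y ↦ f y v) x) :
    ContMDiffAt 𝓘(ℝ, E) 𝓘(ℝ, G →L[ℝ] F) n f x := by
  let b := finBasis ℝ G
  -- In finite dimension an operator is a finite sum of rank-one operators, each depending linearly
  -- and continuously on one value `f y (b i)`.
  have key : f = fun y ↦ ∑ i, ContinuousLinearMap.smulRightL ℝ G F
      (LinearMap.toContinuousLinearMap (b.coord i)) (f y (b i)) := by
    ext y v
    conv_lhs => rw [← b.sum_repr v, map_sum]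
    simp
  rw [key]
  refine contMDiffAt_finsetSum fun i _ ↦ ?_
  exact (ContinuousLinearMap.contMDiff _).contMDiffAt.comp x (h (b i))

variable [IsManifold 𝓘(ℝ, E) ∞ M] [FiniteDimensional ℝ E] [T2Space M]

/-- A constant coordinate vector is, near `x`, the coordinate expression of a global smooth field,
so testing on global fields controls every column of `σ`. Smoothness of a connection is thereby
reduced to that of the fields `∇_X Y`. -/
theorem contMDiff_hom_of_forall_apply
    {σ : Π x : M, TangentSpace 𝓘(ℝ, E) x →L[ℝ] TangentSpace 𝓘(ℝ, E) x}
    (h : ∀ X : Π x : M, TangentSpace 𝓘(ℝ, E) x, IsSmoothField X →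
      IsSmoothField (fun x ↦ σ x (X x))) :
    ContMDiff 𝓘(ℝ, E) (𝓘(ℝ, E).prod 𝓘(ℝ, E →L[ℝ] E)) ∞
      (fun x ↦ (⟨x, σ x⟩ : TotalSpace (E →L[ℝ] E)
        fun x : M ↦ TangentSpace 𝓘(ℝ, E) x →L[ℝ] TangentSpace 𝓘(ℝ, E) x)) := by
  intro x
  rw [contMDiffAt_hom_bundle]
  refine ⟨contMDiffAt_id, contMDiffAt_of_forall_apply fun w ↦ ?_⟩
  set e := trivializationAt E (TangentSpace 𝓘(ℝ, E) : M → Type _) x with he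
  obtain ⟨X, hX, hXe⟩ := exists_isSmoothField_eventuallyEq_extend (e.symm x w)
  have := (contMDiffAt_section x).1 (h X hX x)
  refine this.congr_of_eventuallyEq ?_
  have hb : ∀ᶠ y in 𝓝 x, y ∈ e.baseSet :=
    e.open_baseSet.mem_nhds (mem_baseSet_trivializationAt E _ x)
  filter_upwards [hXe, hb] with y hy hyb
  rw [ContinuousLinearMap.inCoordinates_eq hyb hyb, hy]
  simp only [extend, ContinuousLinearMap.comp_apply]
  rw [Trivialization.apply_mk_symm _ (mem_baseSet_trivializationAt E _ x)]
  rfl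

section Riemannian

variable [RiemannianBundle (fun x : M ↦ TangentSpace 𝓘(ℝ, E) x)]
  [IsContMDiffRiemannianBundle 𝓘(ℝ, E) ∞ E (fun x : M ↦ TangentSpace 𝓘(ℝ, E) x)]

omit [FiniteDimensional ℝ E] [T2Space M] in
theorem IsSmoothField.inner {X Y : Π x : M, TangentSpace 𝓘(ℝ, E) x}
    (hX : IsSmoothField X) (hY : IsSmoothField Y) :
    ContMDiff 𝓘(ℝ, E) 𝓘(ℝ, ℝ) ∞ (fun x ↦ inner ℝ (X x) (Y x)) :=
  ContMDiff.inner_bundle (b := fun x ↦ x) hX hY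

/-- The metric in the coordinates of the trivialization at `x`. -/
def coordMetric (x y : M) : E →L[ℝ] E →L[ℝ] ℝ :=
  (innerSL ℝ : TangentSpace 𝓘(ℝ, E) y →L[ℝ] TangentSpace 𝓘(ℝ, E) y →L[ℝ] ℝ).bilinearComp
    ((trivializationAt E (TangentSpace 𝓘(ℝ, E) : M → Type _) x).symmL ℝ y)
    ((trivializationAt E (TangentSpace 𝓘(ℝ, E) : M → Type _) x).symmL ℝ y)

omit [FiniteDimensional ℝ E] [T2Space M]
  [IsContMDiffRiemannianBundle 𝓘(ℝ, E) ∞ E (fun x : M ↦ TangentSpace 𝓘(ℝ, E) x)] in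
theorem coordMetric_apply {x y : M}
    (hy : y ∈ (trivializationAt E (TangentSpace 𝓘(ℝ, E) : M → Type _) x).baseSet) (v w : E) :
    coordMetric x y v w =
    inner ℝ ((trivializationAt E (TangentSpace 𝓘(ℝ, E) : M → Type _) x).symm y v)
      ((trivializationAt E (TangentSpace 𝓘(ℝ, E) : M → Type _) x).symm y w) := by
  rw [coordMetric, ContinuousLinearMap.bilinearComp_apply, Trivialization.symmL_apply _ hy,
    Trivialization.symmL_apply _ hy]
  rfl

theorem contMDiffAt_coordMetric (x : M) :
    ContMDiffAt 𝓘(ℝ, E) 𝓘(ℝ, E →L[ℝ] E →L[ℝ] ℝ) ∞ (coordMetric (E := E) x) x := by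
  set e := trivializationAt E (TangentSpace 𝓘(ℝ, E) : M → Type _) x with he
  refine contMDiffAt_of_forall_apply fun v ↦ contMDiffAt_of_forall_apply fun w ↦ ?_
  obtain ⟨X, hX, hXe⟩ := exists_isSmoothField_eventuallyEq_extend (e.symm x v)
  obtain ⟨Y, hY, hYe⟩ := exists_isSmoothField_eventuallyEq_extend (e.symm x w)
  refine (hX.inner hY x).congr_of_eventuallyEq ?_
  have hb : ∀ᶠ y in 𝓝 x, y ∈ e.baseSet :=
    e.open_baseSet.mem_nhds (mem_baseSet_trivializationAt E _ x)
  filter_upwards [hXe, hYe, hb] with y hy hy' hyb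
  rw [coordMetric_apply hyb, hy, hy']
  simp only [extend]
  rw [Trivialization.apply_mk_symm _ (mem_baseSet_trivializationAt E _ x),
    Trivialization.apply_mk_symm _ (mem_baseSet_trivializationAt E _ x)]

omit [FiniteDimensional ℝ E] [T2Space M]
  [IsContMDiffRiemannianBundle 𝓘(ℝ, E) ∞ E (fun x : M ↦ TangentSpace 𝓘(ℝ, E) x)] in
theorem coordMetric_self_injective (x : M) : Function.Injective (coordMetric (E := E) x x) := by
  set e := trivializationAt E (TangentSpace 𝓘(ℝ, E) : M → Type _) x with he
  rw [injective_iff_map_eq_zero]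
  intro v hv
  have h := congr($hv v)
  rw [coordMetric_apply (mem_baseSet_trivializationAt E _ x)] at h
  have h0 : e.symm x v = 0 := by simpa using h
  have := Trivialization.apply_mk_symm e (mem_baseSet_trivializationAt E _ x) v
  rw [h0] at this
  have h2 : e ⟨x, 0⟩ = (x, 0) :=
    e.zeroSection ℝ (mem_baseSet_trivializationAt E (TangentSpace 𝓘(ℝ, E) : M → Type _) x)
  rw [h2] at this
  exact congr(($this).2).symm

omit [T2Space M]
  [IsContMDiffRiemannianBundle 𝓘(ℝ, E) ∞ E (fun x : M ↦ TangentSpace 𝓘(ℝ, E) x)] in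
theorem exists_continuousLinearEquiv_coordMetric (x : M) :
    ∃ L : E ≃L[ℝ] (E →L[ℝ] ℝ), (L : E →L[ℝ] (E →L[ℝ] ℝ)) = coordMetric x x := by
  have hdim : finrank ℝ E = finrank ℝ (E →L[ℝ] ℝ) := by
    rw [← (LinearMap.toContinuousLinearMap (𝕜 := ℝ) (E := E) (F' := ℝ)).finrank_eq]
    exact Subspace.dual_finrank_eq.symm
  refine ⟨(LinearEquiv.ofInjectiveOfFinrankEq ((coordMetric x x : E →L[ℝ] (E →L[ℝ] ℝ)) : E →ₗ[ℝ] (E →L[ℝ] ℝ))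
    (coordMetric_self_injective x) hdim).toContinuousLinearEquiv, ?_⟩
  ext v w
  rfl

/-- In coordinates `W = G⁻¹(G W)`, where `G` is the Gram operator of the metric; `G W` is smooth by
hypothesis, and inversion is smooth on invertible operators. Tensors defined through their inner
products become smooth by this test. -/
theorem isSmoothField_of_forall_inner {W : Π x : M, TangentSpace 𝓘(ℝ, E) x}
    (h : ∀ Z : Π x : M, TangentSpace 𝓘(ℝ, E) x, IsSmoothField Z →
      ContMDiff 𝓘(ℝ, E) 𝓘(ℝ, ℝ) ∞ (fun x ↦ inner ℝ (W x) (Z x))) :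
    IsSmoothField W := by
  intro x
  set e := trivializationAt E (TangentSpace 𝓘(ℝ, E) : M → Type _) x with he
  rw [contMDiffAt_section]
  obtain ⟨L, hL⟩ := exists_continuousLinearEquiv_coordMetric (E := E) x
  have hinv : ContMDiffAt 𝓘(ℝ, E) 𝓘(ℝ, (E →L[ℝ] ℝ) →L[ℝ] E) ∞
      (fun y ↦ ContinuousLinearMap.inverse (coordMetric (E := E) x y)) x := by
    have : ContDiffAt ℝ ∞ ContinuousLinearMap.inverse (coordMetric (E := E) x x) :=
      hL ▸ contDiffAt_map_inverse L
    exact this.contMDiffAt.comp x (contMDiffAt_coordMetric x)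
  have hdual : ContMDiffAt 𝓘(ℝ, E) 𝓘(ℝ, E →L[ℝ] ℝ) ∞
      (fun y ↦ coordMetric x y (e ⟨y, W y⟩).2) x := by
    refine contMDiffAt_of_forall_apply fun w ↦ ?_
    obtain ⟨Z, hZ, hZe⟩ := exists_isSmoothField_eventuallyEq_extend (e.symm x w)
    refine (h Z hZ x).congr_of_eventuallyEq ?_
    have hb : ∀ᶠ y in 𝓝 x, y ∈ e.baseSet :=
      e.open_baseSet.mem_nhds (mem_baseSet_trivializationAt E _ x)
    filter_upwards [hZe, hb] with y hy hyb
    rw [coordMetric_apply hyb, hy]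
    simp only [extend]
    rw [Trivialization.apply_mk_symm _ (mem_baseSet_trivializationAt E _ x),
      Trivialization.symm_proj_apply e ⟨y, W y⟩ hyb]
  refine (hinv.clm_apply hdual).congr_of_eventuallyEq ?_
  -- `ContinuousLinearMap.inverse` has the value zero off the invertible maps; these form an open
  -- set, so near `x` it is a true inverse.
  have hev : ∀ᶠ y in 𝓝 x, coordMetric x y ∈
      range ((↑) : (E ≃L[ℝ] (E →L[ℝ] ℝ)) → (E →L[ℝ] (E →L[ℝ] ℝ))) :=
    (contMDiffAt_coordMetric x).continuousAt.eventually
      (by rw [← hL]; exact ContinuousLinearEquiv.nhds L)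
  filter_upwards [hev] with y ⟨L', hL'⟩
  rw [← hL', ContinuousLinearMap.inverse_equiv]
  simp [he]

end Riemannian

end SmoothnessTests

end Randers

end

noncomputable section

namespace Randers

open Filter Topology Module FiberBundle

variable {E : Type*} [NormedAddCommGroup E] [NormedSpace ℝ E]
  {M : Type*} [TopologicalSpace M] [ChartedSpace E M]

/-! ### Covariant derivatives of fields along curves -/

section AlongCurves

theorem hasDerivWithinAt_comp_curve {F : Type*} [NormedAddCommGroup F] [NormedSpace ℝ F]
    {γ : ℝ → M} {s : Set ℝ} {t : ℝ} {f : M → F} (hf : MDiffAt f (γ t)) (hγ : MDiffAt[s] γ t) :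
    HasDerivWithinAt (fun r ↦ f (γ r))
      (mvfderiv 𝓘(ℝ, E) f (γ t) (mfderivWithin 𝓘(ℝ, ℝ) 𝓘(ℝ, E) γ s t (1 : ℝ))) s t := by
  have h := hf.hasMFDerivAt.comp_hasMFDerivWithinAt t hγ.hasMFDerivWithinAt
  have h' : HasFDerivWithinAt (fun r ↦ f (γ r)) ((mvfderiv 𝓘(ℝ, E) f (γ t)).comp
      (mfderivWithin 𝓘(ℝ, ℝ) 𝓘(ℝ, E) γ s t) : ℝ →L[ℝ] F) s t :=
    hasMFDerivWithinAt_iff_hasFDerivWithinAt.1 h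
  exact h'.hasDerivWithinAt

theorem mvfderiv_congr {F : Type*} [NormedAddCommGroup F] [NormedSpace ℝ F] {x : M} {f g : M → F}
    (h : f =ᶠ[𝓝 x] g) : mvfderiv 𝓘(ℝ, E) f x = mvfderiv 𝓘(ℝ, E) g x := by
  ext v
  simp only [mvfderiv, h.mfderiv_eq]
  rfl

theorem mvfderiv_clm_comp {F G : Type*} [NormedAddCommGroup F] [NormedSpace ℝ F]
    [NormedAddCommGroup G] [NormedSpace ℝ G] (L : F →L[ℝ] G) {x : M} {f : M → F} (hf : MDiffAt f x)
    (u : TangentSpace 𝓘(ℝ, E) x) :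
    mvfderiv 𝓘(ℝ, E) (fun y ↦ L (f y)) x u = L (mvfderiv 𝓘(ℝ, E) f x u) := by
  have h : HasMFDerivAt 𝓘(ℝ, E) 𝓘(ℝ, G) (fun y ↦ L (f y)) x _ :=
    (L.hasMFDerivAt (x := f x)).comp x hf.hasMFDerivAt
  simp only [mvfderiv, h.mfderiv]
  rfl

theorem mvfderiv_clm_apply {F G : Type*} [NormedAddCommGroup F] [NormedSpace ℝ F]
    [NormedAddCommGroup G] [NormedSpace ℝ G]
    {x : M} {f : M → F →L[ℝ] G} (hf : MDiffAt f x) (u : TangentSpace 𝓘(ℝ, E) x) (a : F) :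
    mvfderiv 𝓘(ℝ, E) (fun y ↦ f y a) x u = mvfderiv 𝓘(ℝ, E) f x u a :=
  mvfderiv_clm_comp (ContinuousLinearMap.apply ℝ G a) hf u

variable [IsManifold 𝓘(ℝ, E) ∞ M]

theorem mdifferentiableAt_coord {x : M} {Y : Π y : M, TangentSpace 𝓘(ℝ, E) y}
    (hY : MDiffAt (T% Y) x) :
    MDiffAt (fun y ↦ (trivializationAt E (TangentSpace 𝓘(ℝ, E) : M → Type _) x ⟨y, Y y⟩).2) x :=
  (mdifferentiableAt_section _ Y).1 hY

theorem eventually_mem_baseSet (x : M) :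
    ∀ᶠ y in 𝓝 x, y ∈ (trivializationAt E (TangentSpace 𝓘(ℝ, E) : M → Type _) x).baseSet :=
  (trivializationAt E (TangentSpace 𝓘(ℝ, E) : M → Type _) x).open_baseSet.mem_nhds
    (mem_baseSet_trivializationAt E _ x)

theorem trivializationAt_add {x y : M}
    (hy : y ∈ (trivializationAt E (TangentSpace 𝓘(ℝ, E) : M → Type _) x).baseSet)
    (v w : TangentSpace 𝓘(ℝ, E) y) :
    (trivializationAt E (TangentSpace 𝓘(ℝ, E) : M → Type _) x ⟨y, v + w⟩).2 =
      (trivializationAt E (TangentSpace 𝓘(ℝ, E) : M → Type _) x ⟨y, v⟩).2 +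
      (trivializationAt E (TangentSpace 𝓘(ℝ, E) : M → Type _) x ⟨y, w⟩).2 :=
  (Trivialization.linear ℝ _ hy).map_add v w

theorem trivializationAt_smul {x y : M}
    (hy : y ∈ (trivializationAt E (TangentSpace 𝓘(ℝ, E) : M → Type _) x).baseSet) (c : ℝ)
    (v : TangentSpace 𝓘(ℝ, E) y) :
    (trivializationAt E (TangentSpace 𝓘(ℝ, E) : M → Type _) x ⟨y, c • v⟩).2 =
      c • (trivializationAt E (TangentSpace 𝓘(ℝ, E) : M → Type _) x ⟨y, v⟩).2 :=
  (Trivialization.linear ℝ _ hy).map_smul c v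

theorem eventually_extend_add {x : M} (v w : TangentSpace 𝓘(ℝ, E) x) :
    ∀ᶠ y in 𝓝 x, extend E (v + w) y = extend E v y + extend E w y := by
  filter_upwards [eventually_mem_baseSet (E := E) x] with y hy
  simp only [extend, trivializationAt_add (E := E) (mem_baseSet_trivializationAt E _ x)]
  simp only [← Trivialization.symmL_apply (R := ℝ) _ hy, map_add]

theorem eventually_extend_smul {x : M} (c : ℝ) (v : TangentSpace 𝓘(ℝ, E) x) :
    ∀ᶠ y in 𝓝 x, extend E (c • v) y = c • extend E v y := by
  filter_upwards [eventually_mem_baseSet (E := E) x] with y hy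
  simp only [extend, trivializationAt_smul (E := E) (mem_baseSet_trivializationAt E _ x)]
  simp only [← Trivialization.symmL_apply (R := ℝ) _ hy, map_smul]

/-- The coordinates in the trivialization at `x` of the covariant derivative at `x` of the field
extending `v` with constant coordinates. -/
def christoffel (D : Connection E M) (x : M) (u : TangentSpace 𝓘(ℝ, E) x) :
    TangentSpace 𝓘(ℝ, E) x →ₗ[ℝ] E where
  toFun v := (trivializationAt E (TangentSpace 𝓘(ℝ, E) : M → Type _) x
    ⟨x, D (extend E v) x u⟩).2
  map_add' v w := by
    have hx := mem_baseSet_trivializationAt E (TangentSpace 𝓘(ℝ, E) : M → Type _) x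
    have h := D.isCovariantDerivativeOnUniv.congr_of_eventuallyEq
      (mdifferentiableAt_extend 𝓘(ℝ, E) E (v + w))
      (mdifferentiableAt_add_section (mdifferentiableAt_extend 𝓘(ℝ, E) E v)
        (mdifferentiableAt_extend 𝓘(ℝ, E) E w)) univ_mem (eventually_extend_add v w)
    rw [h, D.isCovariantDerivativeOnUniv.add (mdifferentiableAt_extend ..)
      (mdifferentiableAt_extend ..)]
    exact trivializationAt_add hx _ _
  map_smul' c v := by
    have hx := mem_baseSet_trivializationAt E (TangentSpace 𝓘(ℝ, E) : M → Type _) x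
    have h : D (extend E (c • v)) x = D (c • extend E v) x :=
      D.isCovariantDerivativeOnUniv.congr_of_eventuallyEq
        (mdifferentiableAt_extend 𝓘(ℝ, E) E (c • v))
        (mdifferentiableAt_extend 𝓘(ℝ, E) E v).smul_const_section univ_mem
        (eventually_extend_smul c v)
    rw [h, D.isCovariantDerivativeOnUniv.smul_const c (mdifferentiableAt_extend ..)]
    exact trivializationAt_smul hx _ _

/-- The expression of a covariant derivative in coordinates. -/
theorem coord_covariantDerivative [FiniteDimensional ℝ E] (D : Connection E M) {x : M}
    (u : TangentSpace 𝓘(ℝ, E) x) {Y : Π y : M, TangentSpace 𝓘(ℝ, E) y} (hY : MDiffAt (T% Y) x) :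
    (trivializationAt E (TangentSpace 𝓘(ℝ, E) : M → Type _) x ⟨x, D Y x u⟩).2 =
      mvfderiv 𝓘(ℝ, E)
        (fun y ↦ (trivializationAt E (TangentSpace 𝓘(ℝ, E) : M → Type _) x ⟨y, Y y⟩).2) x u
      + christoffel D x u (Y x) := by
  set e := trivializationAt E (TangentSpace 𝓘(ℝ, E) : M → Type _) x with he
  have hx : x ∈ e.baseSet := mem_baseSet_trivializationAt E _ x
  have hb : ∀ᶠ y in 𝓝 x, y ∈ e.baseSet := eventually_mem_baseSet x
  -- The connection minus the coordinate derivative is tensorial, so it depends on `Y x` only and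
  -- may be evaluated on the extension with constant coordinates, whose coordinate derivative is
  -- zero.
  have htens : TensorialAt 𝓘(ℝ, E) E (V := (TangentSpace 𝓘(ℝ, E) : M → Type _))
      (fun Y ↦ (e ⟨x, D Y x u⟩).2 - mvfderiv 𝓘(ℝ, E) (fun y ↦ (e ⟨y, Y y⟩).2) x u) x := by
    constructor
    · intro f σ hf hσ
      have h1 : mvfderiv 𝓘(ℝ, E) (fun y ↦ (e ⟨y, (f • σ) y⟩).2) x =
          mvfderiv 𝓘(ℝ, E) (fun y ↦ f y • (e ⟨y, σ y⟩).2) x := by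
        refine mvfderiv_congr ?_
        filter_upwards [hb] with y hy
        exact trivializationAt_smul hy _ _
      rw [h1, mvfderiv_fun_smul hf (mdifferentiableAt_coord hσ),
        D.isCovariantDerivativeOnUniv.leibniz hσ hf]
      simp [he, trivializationAt_add hx, trivializationAt_smul hx]
      module
    · intro σ τ hσ hτ
      have h1 : mvfderiv 𝓘(ℝ, E) (fun y ↦ (e ⟨y, (σ + τ) y⟩).2) x =
          mvfderiv 𝓘(ℝ, E) (fun y ↦ (e ⟨y, σ y⟩).2 + (e ⟨y, τ y⟩).2) x := by
        refine mvfderiv_congr ?_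
        filter_upwards [hb] with y hy
        exact trivializationAt_add hy _ _
      rw [h1, mvfderiv_fun_add (mdifferentiableAt_coord hσ) (mdifferentiableAt_coord hτ),
        D.isCovariantDerivativeOnUniv.add hσ hτ]
      simp [he, trivializationAt_add hx]
      module
  have key := htens.pointwise hY (mdifferentiableAt_extend 𝓘(ℝ, E) E (Y x)) (by simp)
  have h0 : mvfderiv 𝓘(ℝ, E) (fun y ↦ (e ⟨y, extend E (Y x) y⟩).2) x = 0 := by
    have : (fun y ↦ (e ⟨y, extend E (Y x) y⟩).2) =ᶠ[𝓝 x] fun _ ↦ (e ⟨x, Y x⟩).2 := by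
      filter_upwards [hb] with y hy
      simp only [extend, ← he]
      rw [Trivialization.apply_mk_symm _ hy]
    rw [mvfderiv_congr this]
    simp [mvfderiv]
  rw [h0] at key
  simp only [zero_apply, sub_zero] at key
  rw [sub_eq_iff_eq_add'] at key
  exact key

/-- The covariant derivative at time `t` of the field `V` along the curve `γ` is `W`. -/
def HasCovDerivWithinAt (D : Connection E M) (γ : ℝ → M) (V : Π r : ℝ, TangentSpace 𝓘(ℝ, E) (γ r))
    (s : Set ℝ) (t : ℝ) (W : TangentSpace 𝓘(ℝ, E) (γ t)) : Prop :=
  HasDerivWithinAt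
    (fun r : ℝ ↦ (trivializationAt E (TangentSpace 𝓘(ℝ, E) : M → Type _) (γ t) ⟨γ r, V r⟩).2)
    ((trivializationAt E (TangentSpace 𝓘(ℝ, E) : M → Type _) (γ t) ⟨γ t, W⟩).2
      - christoffel D (γ t) (mfderivWithin 𝓘(ℝ, ℝ) 𝓘(ℝ, E) γ s t (1 : ℝ)) (V t)) s t

theorem trivializationAt_zero {x y : M}
    (hy : y ∈ (trivializationAt E (TangentSpace 𝓘(ℝ, E) : M → Type _) x).baseSet) :
    (trivializationAt E (TangentSpace 𝓘(ℝ, E) : M → Type _) x ⟨y, 0⟩).2 = 0 :=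
  (Trivialization.linear ℝ _ hy).map_zero

theorem isParallelAlong_iff {D : Connection E M} {γ : ℝ → M} {a b : ℝ}
    {V : Π r : ℝ, TangentSpace 𝓘(ℝ, E) (γ r)} :
    IsParallelAlong D γ a b V ↔ ∀ t ∈ Icc a b, HasCovDerivWithinAt D γ V (Icc a b) t 0 := by
  refine forall₂_congr fun t ht ↦ ?_
  rw [HasCovDerivWithinAt, trivializationAt_zero (mem_baseSet_trivializationAt E _ _), zero_sub]
  rfl

section Rules

variable {D : Connection E M} {γ : ℝ → M} {V V' : Π r : ℝ, TangentSpace 𝓘(ℝ, E) (γ r)}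
  {s : Set ℝ} {t : ℝ} {W W' : TangentSpace 𝓘(ℝ, E) (γ t)}

theorem eventually_mem_baseSet_curve (hγ : MDiffAt[s] γ t) : ∀ᶠ r in 𝓝[s] t,
    γ r ∈ (trivializationAt E (TangentSpace 𝓘(ℝ, E) : M → Type _) (γ t)).baseSet :=
  hγ.continuousWithinAt.eventually (eventually_mem_baseSet (γ t))

theorem HasCovDerivWithinAt.congr (h : HasCovDerivWithinAt D γ V s t W)
    (hV : ∀ᶠ r in 𝓝[s] t, V' r = V r) (ht : V' t = V t) : HasCovDerivWithinAt D γ V' s t W := by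
  rw [HasCovDerivWithinAt, ht]
  refine HasDerivWithinAt.congr_of_eventuallyEq h ?_ (by simp only [ht])
  filter_upwards [hV] with r hr
  rw [hr]

theorem HasCovDerivWithinAt.add (hγ : MDiffAt[s] γ t) (h : HasCovDerivWithinAt D γ V s t W)
    (h' : HasCovDerivWithinAt D γ V' s t W') :
    HasCovDerivWithinAt D γ (fun r ↦ V r + V' r) s t (W + W') := by
  have hx := mem_baseSet_trivializationAt E (TangentSpace 𝓘(ℝ, E) : M → Type _) (γ t)
  have key := (HasDerivWithinAt.add h h').congr_of_eventuallyEq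
    (f₁ := fun r : ℝ ↦ (trivializationAt E (TangentSpace 𝓘(ℝ, E) : M → Type _) (γ t)
      ⟨γ r, V r + V' r⟩).2) (by
      filter_upwards [eventually_mem_baseSet_curve hγ] with r hr
      exact trivializationAt_add hr _ _) (trivializationAt_add hx _ _)
  rw [HasCovDerivWithinAt, trivializationAt_add hx, map_add]
  convert key using 1
  abel

theorem HasCovDerivWithinAt.smul (hγ : MDiffAt[s] γ t) {c : ℝ → ℝ} {c' : ℝ}
    (hc : HasDerivWithinAt c c' s t) (h : HasCovDerivWithinAt D γ V s t W) :
    HasCovDerivWithinAt D γ (fun r ↦ c r • V r) s t (c' • V t + c t • W) := by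
  have hx := mem_baseSet_trivializationAt E (TangentSpace 𝓘(ℝ, E) : M → Type _) (γ t)
  have key := (HasDerivWithinAt.smul hc h).congr_of_eventuallyEq
    (f₁ := fun r : ℝ ↦ (trivializationAt E (TangentSpace 𝓘(ℝ, E) : M → Type _) (γ t)
      ⟨γ r, c r • V r⟩).2) (by
      filter_upwards [eventually_mem_baseSet_curve hγ] with r hr
      exact trivializationAt_smul hr _ _) (trivializationAt_smul hx _ _)
  rw [HasCovDerivWithinAt, trivializationAt_add hx, trivializationAt_smul hx,
    trivializationAt_smul hx, map_smul]
  convert key using 1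
  module

theorem hasCovDerivWithinAt_zero (hγ : MDiffAt[s] γ t) :
    HasCovDerivWithinAt D γ (fun _ ↦ 0) s t 0 := by
  have hx := mem_baseSet_trivializationAt E (TangentSpace 𝓘(ℝ, E) : M → Type _) (γ t)
  rw [HasCovDerivWithinAt, map_zero, trivializationAt_zero hx, sub_zero]
  refine (hasDerivWithinAt_const t s (0 : E)).congr_of_eventuallyEq ?_ (trivializationAt_zero hx)
  filter_upwards [eventually_mem_baseSet_curve hγ] with r hr
  exact trivializationAt_zero hr

theorem HasCovDerivWithinAt.sum (hγ : MDiffAt[s] γ t) {ι : Type*} (S : Finset ι)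
    {V : ι → Π r : ℝ, TangentSpace 𝓘(ℝ, E) (γ r)} {W : ι → TangentSpace 𝓘(ℝ, E) (γ t)}
    (h : ∀ i ∈ S, HasCovDerivWithinAt D γ (V i) s t (W i)) :
    HasCovDerivWithinAt D γ (fun r ↦ ∑ i ∈ S, V i r) s t (∑ i ∈ S, W i) := by
  classical
  induction S using Finset.induction_on with
  | empty => simpa using hasCovDerivWithinAt_zero hγ
  | insert a S ha ih =>
    simp only [Finset.sum_insert ha]
    exact (h a (by simp)).add hγ (ih fun i hi ↦ h i (by simp [hi]))

variable [FiniteDimensional ℝ E]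

theorem hasCovDerivWithinAt_field (hγ : MDiffAt[s] γ t) {Y : Π y : M, TangentSpace 𝓘(ℝ, E) y}
    (hY : MDiffAt (T% Y) (γ t)) :
    HasCovDerivWithinAt D γ (fun r ↦ Y (γ r)) s t
      (D Y (γ t) (mfderivWithin 𝓘(ℝ, ℝ) 𝓘(ℝ, E) γ s t (1 : ℝ))) := by
  rw [HasCovDerivWithinAt, coord_covariantDerivative D _ hY, add_sub_cancel_right]
  exact hasDerivWithinAt_comp_curve (mdifferentiableAt_coord hY) hγ

section Riemannian

variable [T2Space M] [RiemannianBundle (fun x : M ↦ TangentSpace 𝓘(ℝ, E) x)]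
  [IsContMDiffRiemannianBundle 𝓘(ℝ, E) ∞ E (fun x : M ↦ TangentSpace 𝓘(ℝ, E) x)]

omit [FiniteDimensional ℝ E] [T2Space M]
  [IsContMDiffRiemannianBundle 𝓘(ℝ, E) ∞ E (fun x : M ↦ TangentSpace 𝓘(ℝ, E) x)] in
theorem coordMetric_trivializationAt {x y : M}
    (hy : y ∈ (trivializationAt E (TangentSpace 𝓘(ℝ, E) : M → Type _) x).baseSet)
    (v w : TangentSpace 𝓘(ℝ, E) y) :
    coordMetric x y (trivializationAt E (TangentSpace 𝓘(ℝ, E) : M → Type _) x ⟨y, v⟩).2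
      (trivializationAt E (TangentSpace 𝓘(ℝ, E) : M → Type _) x ⟨y, w⟩).2 = inner ℝ v w := by
  rw [coordMetric_apply hy, Trivialization.symm_proj_apply _ ⟨y, v⟩ hy,
    Trivialization.symm_proj_apply _ ⟨y, w⟩ hy]

theorem mvfderiv_coordMetric (x : M) (u v w : TangentSpace 𝓘(ℝ, E) x) :
    mvfderiv 𝓘(ℝ, E) (coordMetric x) x u
      (trivializationAt E (TangentSpace 𝓘(ℝ, E) : M → Type _) x ⟨x, v⟩).2
      (trivializationAt E (TangentSpace 𝓘(ℝ, E) : M → Type _) x ⟨x, w⟩).2 =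
    mvfderiv 𝓘(ℝ, E) (fun y ↦ inner ℝ (extend E v y) (extend E w y)) x u := by
  set a := (trivializationAt E (TangentSpace 𝓘(ℝ, E) : M → Type _) x ⟨x, v⟩).2
  set b := (trivializationAt E (TangentSpace 𝓘(ℝ, E) : M → Type _) x ⟨x, w⟩).2
  have h1 : (fun y ↦ inner ℝ (extend E v y) (extend E w y)) =ᶠ[𝓝 x]
      fun y ↦ coordMetric x y a b := by
    filter_upwards [eventually_mem_baseSet (E := E) x] with y hy
    rw [coordMetric_apply hy]
    rfl
  rw [mvfderiv_congr h1]
  have h2 : MDiffAt (coordMetric (E := E) x) x :=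
    (contMDiffAt_coordMetric x).mdifferentiableAt (by simp)
  have h3 : MDiffAt (fun y ↦ coordMetric (E := E) x y a) x :=
    h2.clm_apply mdifferentiableAt_const
  rw [mvfderiv_clm_apply h3, mvfderiv_clm_apply h2]

/-- Differentiate `G(γ)(v, v')` in coordinates: the derivative of `G` and the two Christoffel terms
combine into the covariant derivative of the metric, the only deviation from the usual product rule.
-/
theorem HasCovDerivWithinAt.inner (hγ : MDiffAt[s] γ t) (h : HasCovDerivWithinAt D γ V s t W)
    (h' : HasCovDerivWithinAt D γ V' s t W') :
    HasDerivWithinAt (fun r ↦ inner ℝ (V r) (V' r))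
      (inner ℝ W (V' t) + inner ℝ (V t) W' + CovariantDerivative.derivMetricTensor D (γ t) (V t)
        (V' t) (mfderivWithin 𝓘(ℝ, ℝ) 𝓘(ℝ, E) γ s t (1 : ℝ))) s t := by
  have hx := mem_baseSet_trivializationAt E (TangentSpace 𝓘(ℝ, E) : M → Type _) (γ t)
  have hG : MDiffAt (coordMetric (γ t)) (γ t) :=
    (contMDiffAt_coordMetric (γ t)).mdifferentiableAt (by simp)
  have key := ((hasDerivWithinAt_comp_curve hG hγ).clm_apply h).clm_apply h'
  have key2 := key.congr_of_eventuallyEq (f₁ := fun r ↦ Inner.inner ℝ (V r) (V' r)) (by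
    filter_upwards [eventually_mem_baseSet_curve hγ] with r hr
    exact (coordMetric_trivializationAt hr _ _).symm) (coordMetric_trivializationAt hx _ _).symm
  refine key2.congr_deriv ?_
  rw [CovariantDerivative.derivMetricTensor_apply_eq_extend, ← mvfderiv_coordMetric]
  have h1 (v w) : coordMetric (γ t) (γ t) (christoffel D (γ t) (mfderivWithin 𝓘(ℝ, ℝ) 𝓘(ℝ, E) γ s t
      (1 : ℝ)) v) (trivializationAt E (TangentSpace 𝓘(ℝ, E) : M → Type _) (γ t) ⟨γ t, w⟩).2 =
      Inner.inner ℝ (D (extend E v) (γ t) (mfderivWithin 𝓘(ℝ, ℝ) 𝓘(ℝ, E) γ s t (1 : ℝ))) w :=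
    coordMetric_trivializationAt hx _ _
  have h2 (v w) : coordMetric (γ t) (γ t)
      (trivializationAt E (TangentSpace 𝓘(ℝ, E) : M → Type _) (γ t) ⟨γ t, w⟩).2
      (christoffel D (γ t) (mfderivWithin 𝓘(ℝ, ℝ) 𝓘(ℝ, E) γ s t (1 : ℝ)) v) =
      Inner.inner ℝ w (D (extend E v) (γ t) (mfderivWithin 𝓘(ℝ, ℝ) 𝓘(ℝ, E) γ s t (1 : ℝ))) :=
    coordMetric_trivializationAt hx _ _
  simp only [map_sub, add_apply, sub_apply, coordMetric_trivializationAt hx, h1, h2]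
  ring

end Riemannian

end Rules

end AlongCurves

end Randers

end

noncomputable section

namespace Randers

open Filter Topology Module FiberBundle

variable {E : Type*} [NormedAddCommGroup E] [NormedSpace ℝ E] [FiniteDimensional ℝ E]
  {M : Type*} [TopologicalSpace M] [T2Space M] [ChartedSpace E M] [IsManifold 𝓘(ℝ, E) ∞ M]

/-! ### Metric connections with parallel `β♯` are compatible -/

section Compatible

variable [RiemannianBundle (fun x : M ↦ TangentSpace 𝓘(ℝ, E) x)]
  [IsContMDiffRiemannianBundle 𝓘(ℝ, E) ∞ E (fun x : M ↦ TangentSpace 𝓘(ℝ, E) x)]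
  {β : Π x : M, TangentSpace 𝓘(ℝ, E) x →L[ℝ] ℝ}

/-- A connection is metric if the derivative of the metric vanishes. -/
def IsMetric (D : Connection E M) : Prop :=
  ∀ (x : M) (u v w : TangentSpace 𝓘(ℝ, E) x), CovariantDerivative.derivMetricTensor D x v w u = 0

theorem isSmoothField_sharp (hβ : IsRandersMetric β) : IsSmoothField (sharp β) := by
  refine isSmoothField_of_forall_inner fun Z hZ ↦ ?_
  simp only [inner_sharp]
  intro x
  have h : ContMDiffAt 𝓘(ℝ, E) (𝓘(ℝ, E).prod 𝓘(ℝ)) ∞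
      (fun m ↦ TotalSpace.mk' ℝ (E := Bundle.Trivial M ℝ) m (β m (Z m))) x := by
    apply ContMDiffAt.clm_bundle_apply (F₁ := E) (F₂ := ℝ) (b := fun m ↦ m)
    · exact hβ.smooth x
    · exact hZ x
  exact (contMDiffAt_totalSpace.1 h).2

omit [T2Space M]
  [IsContMDiffRiemannianBundle 𝓘(ℝ, E) ∞ E (fun x : M ↦ TangentSpace 𝓘(ℝ, E) x)] in
theorem randersNorm_eq (x : M) (v : TangentSpace 𝓘(ℝ, E) x) :
    randersNorm β x v = √(inner ℝ v v) + inner ℝ (sharp β x) v := by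
  rw [inner_sharp]; rfl

theorem eq_of_hasDerivWithinAt_zero {f : ℝ → ℝ} {a b : ℝ} (hab : a ≤ b)
    (h : ∀ t ∈ Icc a b, HasDerivWithinAt f 0 (Icc a b) t) : f b = f a := by
  refine constant_of_derivWithin_zero (fun t ht ↦ (h t ht).differentiableWithinAt)
    (fun t ht ↦ ?_) b (right_mem_Icc.2 hab)
  exact (h t (Ico_subset_Icc_self ht)).derivWithin
    (uniqueDiffOn_Icc (ht.1.trans_lt ht.2) t (Ico_subset_Icc_self ht))

/-- Along a parallel field `V`, both `⟨V, V⟩` and `⟨β♯, V⟩` have derivative zero, and `F(V)` is a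
function of these two. -/
theorem isCompatible_of_isMetricCompatible {D : Connection E M} (hβ : IsRandersMetric β)
    (hs : CovariantDerivative.ContMDiffCovariantDerivative D ∞)
    (hm : IsMetric D) (hB : ∀ x, D (sharp β) x = 0) :
    IsCompatible β D where
  smooth := hs
  preserves γ a b hab hγ v w := by
    rintro ⟨V, hV, rfl, rfl⟩
    rw [isParallelAlong_iff] at hV
    have hγ' : ∀ t ∈ Icc a b, MDiffAt[Icc a b] γ t := hγ.mdifferentiableOn (by simp)
    have h1 : (inner ℝ (V b) (V b) : ℝ) = inner ℝ (V a) (V a) := by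
      refine eq_of_hasDerivWithinAt_zero (f := fun r ↦ inner ℝ (V r) (V r)) hab fun t ht ↦ ?_
      refine (HasCovDerivWithinAt.inner (hγ' t ht) (hV t ht) (hV t ht)).congr_deriv ?_
      simp [hm _]
    have h2 : (inner ℝ (sharp β (γ b)) (V b) : ℝ) = inner ℝ (sharp β (γ a)) (V a) := by
      refine eq_of_hasDerivWithinAt_zero (f := fun r ↦ inner ℝ (sharp β (γ r)) (V r)) hab
        fun t ht ↦ ?_
      refine (HasCovDerivWithinAt.inner (hγ' t ht) (hasCovDerivWithinAt_field (hγ' t ht)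
        ((isSmoothField_sharp hβ).mdiffAt _)) (hV t ht)).congr_deriv ?_
      simp [hm _, hB]
    rw [randersNorm_eq, randersNorm_eq, h1, h2]

end Compatible

/-! ### Short parallel fields along chart lines -/

section ParallelFields

omit [FiniteDimensional ℝ E] in
-- Picard–Lindelöf. A short time interval suffices, since the solution is later only differentiated
-- at time zero.
theorem exists_hasDerivWithinAt_linear [CompleteSpace E] {A : ℝ → E →L[ℝ] E} {ε : ℝ} (hε : 0 < ε)
    (hA : ContinuousOn A (Icc 0 ε)) (v₀ : E) :
    ∃ δ ∈ Ioc 0 ε, ∃ v : ℝ → E, v 0 = v₀ ∧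
      ∀ t ∈ Icc 0 δ, HasDerivWithinAt v (A t (v t)) (Icc 0 δ) t := by
  obtain ⟨C, hC⟩ := isCompact_Icc.exists_bound_of_continuousOn hA
  have hC0 : 0 ≤ C := (norm_nonneg _).trans (hC 0 ⟨le_rfl, hε.le⟩)
  -- `L` bounds the velocity on the unit ball about `v₀`, and time at most `1 / (L + 1)` keeps the
  -- solution in that ball; the added `1` avoids division by zero.
  let L : NNReal := ⟨C * (‖v₀‖ + 1), by positivity⟩
  let K : NNReal := ⟨C, hC0⟩
  let δ := min ε (1 / (L + 1))
  have hL1 : (0 : ℝ) < L + 1 := by positivity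
  have hδ : 0 < δ := lt_min hε (by positivity)
  have hsub : Icc 0 δ ⊆ Icc 0 ε := Icc_subset_Icc_right (min_le_left _ _)
  have hPL : IsPicardLindelof (fun t x ↦ A t x) (tmin := 0) (tmax := δ) ⟨0, le_rfl, hδ.le⟩
      v₀ 1 0 L K := by
    refine ⟨fun t ht ↦ ?_, fun x _ ↦ ?_, fun t ht x hx ↦ ?_, ?_⟩
    · have hK : ‖A t‖₊ ≤ K := hC t (hsub ht)
      exact ((A t).lipschitz.weaken hK).lipschitzOnWith
    · exact (hA.mono hsub).clm_apply continuousOn_const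
    · have hx' : ‖x‖ ≤ ‖v₀‖ + 1 := by
        have := norm_le_norm_add_norm_sub' x v₀
        rw [Metric.mem_closedBall, dist_eq_norm] at hx
        simp only [NNReal.coe_one] at hx
        linarith
      calc ‖A t x‖ ≤ ‖A t‖ * ‖x‖ := (A t).le_opNorm x
        _ ≤ C * (‖v₀‖ + 1) := mul_le_mul (hC t (hsub ht)) hx' (norm_nonneg _) hC0
    · simp only [sub_zero, sub_self, NNReal.coe_one, NNReal.coe_zero]
      rw [max_eq_left hδ.le]
      calc (L : ℝ) * δ ≤ L * (1 / (L + 1)) :=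
            mul_le_mul_of_nonneg_left (min_le_right _ _) L.coe_nonneg
        _ ≤ 1 := by rw [mul_one_div, div_le_one hL1]; linarith
  obtain ⟨v, hv0, hv⟩ := hPL.exists_eq_forall_mem_Icc_hasDerivWithinAt
    (Metric.mem_closedBall_self (by simp))
  exact ⟨δ, ⟨hδ, min_le_left _ _⟩, v, hv0, hv⟩

/-- The curve through `x` which is a straight line in the chart at `x`. -/
def chartLine (x : M) (u : E) (s : ℝ) : M :=
  (extChartAt 𝓘(ℝ, E) x).symm (extChartAt 𝓘(ℝ, E) x x + s • u)

omit [FiniteDimensional ℝ E] [T2Space M] [IsManifold 𝓘(ℝ, E) ∞ M] in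
theorem chartLine_zero (x : M) (u : E) : chartLine x u 0 = x := by
  simp [chartLine]

omit [FiniteDimensional ℝ E] [T2Space M] in
theorem contMDiffAt_chartLine {x : M} {u : E} {s : ℝ}
    (hs : extChartAt 𝓘(ℝ, E) x x + s • u ∈ (extChartAt 𝓘(ℝ, E) x).target) :
    ContMDiffAt 𝓘(ℝ, ℝ) 𝓘(ℝ, E) ∞ (chartLine x u) s := by
  have h1 : ContMDiffAt 𝓘(ℝ, E) 𝓘(ℝ, E) ∞ (extChartAt 𝓘(ℝ, E) x).symm
      (extChartAt 𝓘(ℝ, E) x x + s • u) :=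
    (contMDiffOn_extChartAt_symm x).contMDiffAt
      ((isOpen_extChartAt_target x).mem_nhds hs)
  have h2 : ContMDiffAt 𝓘(ℝ, ℝ) 𝓘(ℝ, E) ∞ (fun r : ℝ ↦ extChartAt 𝓘(ℝ, E) x x + r • u) s := by
    refine ContDiffAt.contMDiffAt ?_
    fun_prop
  exact h1.comp s h2

omit [FiniteDimensional ℝ E] [T2Space M] in
-- The velocity has constant coordinates `u`, so along the line it coincides with a smooth field
-- extending the initial velocity.
theorem mfderiv_chartLine {x : M} {u : E} {s : ℝ}
    (hs : extChartAt 𝓘(ℝ, E) x x + s • u ∈ (extChartAt 𝓘(ℝ, E) x).target) :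
    mfderiv 𝓘(ℝ, ℝ) 𝓘(ℝ, E) (chartLine x u) s (1 : ℝ) =
      (trivializationAt E (TangentSpace 𝓘(ℝ, E) : M → Type _) x).symmL ℝ (chartLine x u s) u := by
  have hsrc : chartLine x u s ∈ (chartAt E x).source := by
    rw [← extChartAt_source 𝓘(ℝ, E)]
    exact (extChartAt 𝓘(ℝ, E) x).map_target hs
  have h1 : MDifferentiableAt 𝓘(ℝ, E) 𝓘(ℝ, E) (extChartAt 𝓘(ℝ, E) x).symm
      (extChartAt 𝓘(ℝ, E) x x + s • u) :=
    ((contMDiffOn_extChartAt_symm (n := ∞) x).contMDiffAt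
      ((isOpen_extChartAt_target x).mem_nhds hs)).mdifferentiableAt (by simp)
  have h2 : HasDerivAt (fun r : ℝ ↦ extChartAt 𝓘(ℝ, E) x x + r • u) u s := by
    simpa using ((hasDerivAt_id s).smul_const u).const_add (extChartAt 𝓘(ℝ, E) x x)
  have h3 := h1.hasMFDerivAt.comp s h2.hasFDerivAt.hasMFDerivAt
  rw [TangentBundle.symmL_trivializationAt hsrc]
  have h4 : extChartAt 𝓘(ℝ, E) x (chartLine x u s) = extChartAt 𝓘(ℝ, E) x x + s • u :=
    (extChartAt 𝓘(ℝ, E) x).right_inv hs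
  have h5 : chartLine x u = (extChartAt 𝓘(ℝ, E) x).symm ∘
    (fun r : ℝ ↦ extChartAt 𝓘(ℝ, E) x x + r • u) := rfl
  rw [h4]
  conv_lhs => rw [h5]
  rw [h3.mfderiv]
  simp only [modelWithCornersSelf_coe, range_id, mfderivWithin_univ]
  exact congrArg _ (one_smul ℝ u)

end ParallelFields

end Randers

end

noncomputable section

namespace Randers

open Filter Topology Module FiberBundle

variable {E : Type*} [NormedAddCommGroup E] [NormedSpace ℝ E] [FiniteDimensional ℝ E]
  {M : Type*} [TopologicalSpace M] [T2Space M] [ChartedSpace E M] [IsManifold 𝓘(ℝ, E) ∞ M]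

section ParallelExistence

omit [FiniteDimensional ℝ E] [T2Space M] in
theorem trivializationAt_sum {x y : M}
    (hy : y ∈ (trivializationAt E (TangentSpace 𝓘(ℝ, E) : M → Type _) x).baseSet)
    {ι : Type*} (S : Finset ι) (v : ι → TangentSpace 𝓘(ℝ, E) y) :
    (trivializationAt E (TangentSpace 𝓘(ℝ, E) : M → Type _) x ⟨y, ∑ i ∈ S, v i⟩).2 =
      ∑ i ∈ S, (trivializationAt E (TangentSpace 𝓘(ℝ, E) : M → Type _) x ⟨y, v i⟩).2 :=
  map_sum (IsLinearMap.mk' _ (Trivialization.linear ℝ _ hy)) v S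

omit [FiniteDimensional ℝ E] [T2Space M] in
theorem IsSmoothField.continuousOn_coord {X : Π x : M, TangentSpace 𝓘(ℝ, E) x}
    (hX : IsSmoothField X) (x : M) :
    ContinuousOn (fun y ↦ (trivializationAt E (TangentSpace 𝓘(ℝ, E) : M → Type _) x ⟨y, X y⟩).2)
      (trivializationAt E (TangentSpace 𝓘(ℝ, E) : M → Type _) x).baseSet :=
  (((trivializationAt E (TangentSpace 𝓘(ℝ, E) : M → Type _) x).contMDiffOn_section_baseSet_iff).1
    hX.contMDiffOn).continuousOn

omit [FiniteDimensional ℝ E] [T2Space M] in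
theorem isSmoothField_covariantDerivative {D : Connection E M}
    (hD : CovariantDerivative.ContMDiffCovariantDerivative D ∞)
    {X Y : Π x : M, TangentSpace 𝓘(ℝ, E) x} (hX : IsSmoothField X) (hY : IsSmoothField Y) :
    IsSmoothField (fun x ↦ D Y x (X x)) := by
  intro x
  have h := hD.contMDiff.contMDiff (σ := Y) (by simpa using hY.contMDiffOn)
  exact ContMDiffAt.clm_bundle_apply (F₁ := E) (F₂ := E) (b := fun m ↦ m)
    (contMDiffOn_univ.1 h x) (hX x)

/-- Local existence of parallel fields along a short line in a chart. -/
theorem exists_parallel {D : Connection E M}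
    (hD : CovariantDerivative.ContMDiffCovariantDerivative D ∞) (x : M)
    (u₀ : TangentSpace 𝓘(ℝ, E) x) :
    ∃ γ : ℝ → M, γ 0 = x ∧ ∃ ε > 0, ContMDiffOn 𝓘(ℝ, ℝ) 𝓘(ℝ, E) ∞ γ (Icc 0 ε) ∧
      (∀ b ∈ Ioc 0 ε, (mfderivWithin 𝓘(ℝ, ℝ) 𝓘(ℝ, E) γ (Icc 0 b) 0 (1 : ℝ) : E) = (u₀ : E)) ∧
      ∀ v₀ : TangentSpace 𝓘(ℝ, E) (γ 0), ∃ δ ∈ Ioc 0 ε, ∃ V : Π r : ℝ, TangentSpace 𝓘(ℝ, E) (γ r),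
        V 0 = v₀ ∧ ∀ b ∈ Ioc 0 δ, IsParallelAlong D γ 0 b V := by
  set e := trivializationAt E (TangentSpace 𝓘(ℝ, E) : M → Type _) x with he
  have hx : x ∈ e.baseSet := mem_baseSet_trivializationAt E _ x
  set u : E := (e ⟨x, u₀⟩).2 with hu
  set γ := chartLine x u with hγdef
  have hγ0 : γ 0 = x := chartLine_zero x u
  let b := finBasis ℝ E
  choose σ hσ hσe using fun i ↦ exists_isSmoothField_eventuallyEq_extend (e.symm x (b i))
  obtain ⟨U, hU, hUe⟩ := exists_isSmoothField_eventuallyEq_extend u₀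
  have hcont0 : ContinuousAt γ 0 := (contMDiffAt_chartLine (by simp)).continuousAt
  have hev : ∀ᶠ s in 𝓝 (0 : ℝ), (∀ i, σ i (γ s) = e.symm (γ s) (b i)) ∧
      U (γ s) = e.symm (γ s) u ∧ γ s ∈ e.baseSet ∧
      extChartAt 𝓘(ℝ, E) x x + s • u ∈ (extChartAt 𝓘(ℝ, E) x).target := by
    have h1 : ∀ᶠ y in 𝓝 x, (∀ i, σ i y = e.symm y (b i)) ∧ U y = e.symm y u ∧
        y ∈ e.baseSet := by
      filter_upwards [eventually_all.2 hσe, hUe, eventually_mem_baseSet (E := E) x] with y h1 h2 h3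
      refine ⟨fun i ↦ ?_, h2, h3⟩
      rw [h1 i]
      simp only [extend]
      rw [Trivialization.apply_mk_symm _ hx]
    have h2 : Tendsto γ (𝓝 0) (𝓝 x) := by simpa [hγ0] using hcont0.tendsto
    have h3 : ∀ᶠ s in 𝓝 (0 : ℝ),
        extChartAt 𝓘(ℝ, E) x x + s • u ∈ (extChartAt 𝓘(ℝ, E) x).target := by
      have : Continuous fun s : ℝ ↦ extChartAt 𝓘(ℝ, E) x x + s • u := by fun_prop
      refine this.continuousAt.eventually ((isOpen_extChartAt_target x).mem_nhds ?_)
      simp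
    filter_upwards [h2.eventually h1, h3] with s hs hs'
    exact ⟨hs.1, hs.2.1, hs.2.2, hs'⟩
  obtain ⟨ρ, hρ, hball⟩ := Metric.eventually_nhds_iff.1 hev
  have hgood : ∀ s ∈ Icc 0 (ρ / 2), (∀ i, σ i (γ s) = e.symm (γ s) (b i)) ∧
      U (γ s) = e.symm (γ s) u ∧ γ s ∈ e.baseSet ∧
      extChartAt 𝓘(ℝ, E) x x + s • u ∈ (extChartAt 𝓘(ℝ, E) x).target := fun s hs ↦ hball (by
    rw [dist_zero_right, Real.norm_of_nonneg hs.1]; linarith [hs.2])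
  have hsmooth : ∀ s ∈ Icc 0 (ρ / 2), ContMDiffAt 𝓘(ℝ, ℝ) 𝓘(ℝ, E) ∞ γ s :=
    fun s hs ↦ contMDiffAt_chartLine (hgood s hs).2.2.2
  -- Replacing the velocity by the global field `U` makes the coefficients of the parallel equation
  -- continuous. All intervals `[0, c]` are needed because the derivative is taken within the
  -- interval.
  have hderiv : ∀ c ∈ Ioc 0 (ρ / 2), ∀ s ∈ Icc 0 c,
      mfderivWithin 𝓘(ℝ, ℝ) 𝓘(ℝ, E) γ (Icc 0 c) s (1 : ℝ) = U (γ s) := by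
    intro c hc s hs
    have hs' : s ∈ Icc 0 (ρ / 2) := ⟨hs.1, hs.2.trans hc.2⟩
    rw [mfderivWithin_eq_mfderiv (uniqueDiffOn_Icc hc.1 s hs).uniqueMDiffWithinAt
      ((hsmooth s hs').mdifferentiableAt (by simp)),
      hγdef, mfderiv_chartLine (hgood s hs').2.2.2, Trivialization.symmL_apply _ (hgood s hs').2.2.1]
    exact (hgood s hs').2.1.symm
  refine ⟨γ, hγ0, ρ / 2, half_pos hρ, fun s hs ↦ (hsmooth s hs).contMDiffWithinAt,
    fun c hc ↦ ?_, fun v₀ ↦ ?_⟩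
  · have h0 : (0 : ℝ) ∈ Icc 0 (ρ / 2) := ⟨le_rfl, (half_pos hρ).le⟩
    have hb0 : (U (γ 0) : E) = (U x : E) := by rw [hγ0]
    have hUx : U x = u₀ := by simpa using hUe.self_of_nhds
    have h1 : (mfderivWithin 𝓘(ℝ, ℝ) 𝓘(ℝ, E) γ (Icc 0 c) 0 (1 : ℝ) : E) = (U (γ 0) : E) :=
      hderiv c hc 0 ⟨le_rfl, hc.1.le⟩
    rw [h1, hb0, hUx]
  -- the coefficients of the equation of parallel fields
  let z : Fin (finrank ℝ E) → ℝ → E := fun i s ↦ (e ⟨γ s, D (σ i) (γ s) (U (γ s))⟩).2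
  have hγc : ContinuousOn γ (Icc 0 (ρ / 2)) :=
    fun s hs ↦ (hsmooth s hs).continuousAt.continuousWithinAt
  have hz : ∀ i, ContinuousOn (z i) (Icc 0 (ρ / 2)) := fun i ↦
    ((isSmoothField_covariantDerivative hD hU (hσ i)).continuousOn_coord x).comp hγc
      fun s hs ↦ (hgood s hs).2.2.1
  -- For `V = ∑ vⁱ σᵢ` the parallel equation, in the fixed trivialization at `x`, is `v' = -∑ vⁱ
  -- ∇_{γ'} σᵢ`.
  let A : ℝ → E →L[ℝ] E := fun s ↦
    -∑ i, ContinuousLinearMap.smulRightL ℝ E E (LinearMap.toContinuousLinearMap (b.coord i)) (z i s)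
  have hA : ContinuousOn A (Icc 0 (ρ / 2)) := by
    refine (continuousOn_finsetSum _ fun i _ ↦ ?_).neg
    exact (ContinuousLinearMap.continuous _).comp_continuousOn (hz i)
  have hAapply (s : ℝ) (w : E) : A s w = -∑ i, b.repr w i • z i s := by
    simp [A]
  obtain ⟨δ, hδ, v, hv0, hv⟩ := exists_hasDerivWithinAt_linear (half_pos hρ) hA (e ⟨γ 0, v₀⟩).2
  refine ⟨δ, hδ, fun r ↦ e.symm (γ r) (v r), ?_, fun c hc ↦ ?_⟩
  · have h0 : γ 0 ∈ e.baseSet := by rw [hγ0]; exact hx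
    simp only [hv0]
    exact Trivialization.symm_proj_apply _ ⟨γ 0, v₀⟩ h0
  rw [isParallelAlong_iff]
  intro t ht
  have hcρ : c ∈ Ioc 0 (ρ / 2) := ⟨hc.1, hc.2.trans hδ.2⟩
  have hsub : Icc 0 c ⊆ Icc 0 (ρ / 2) := Icc_subset_Icc_right hcρ.2
  have hsub' : Icc 0 c ⊆ Icc 0 δ := Icc_subset_Icc_right hc.2
  have hγt : MDiffAt[Icc 0 c] γ t :=
    ((hsmooth t (hsub ht)).mdifferentiableAt (by simp)).mdifferentiableWithinAt
  have hvt := (hv t (hsub' ht)).mono hsub'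
  have hci (i) : HasDerivWithinAt (fun r ↦ b.repr (v r) i) (b.repr (A t (v t)) i) (Icc 0 c) t :=
    ((LinearMap.toContinuousLinearMap (b.coord i)).hasFDerivAt.comp_hasDerivWithinAt t hvt :)
  have hexp : ∀ r ∈ Icc 0 c, e.symm (γ r) (v r) = ∑ i, b.repr (v r) i • σ i (γ r) := by
    intro r hr
    have hr' := hgood r (hsub hr)
    conv_lhs => rw [← b.sum_repr (v r)]
    simp only [hr'.1, ← e.symmL_apply (R := ℝ) hr'.2.2.1, map_sum, map_smul]
  have key := HasCovDerivWithinAt.sum hγt Finset.univ fun i _ ↦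
    HasCovDerivWithinAt.smul hγt (hci i)
      (hasCovDerivWithinAt_field (D := D) hγt ((hσ i).mdiffAt (γ t)))
  have key2 := key.congr (V' := fun r ↦ e.symm (γ r) (v r))
    (eventually_mem_nhdsWithin.mono hexp) (hexp t ht)
  convert key2
  rw [hderiv c hcρ t ht]
  have htb := (hgood t (hsub ht)).2.2.1
  -- Parallelism at time `t` refers to the trivialization at `γ t`, whereas the equation was solved
  -- in the one at `x`. The covariant derivative is a vector, so its vanishing can be read off in
  -- the latter.
  have hzero : (e ⟨γ t, ∑ i, (b.repr (A t (v t)) i • σ i (γ t) +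
      b.repr (v t) i • D (σ i) (γ t) (U (γ t)))⟩).2 = 0 := by
    have hadd (v w : TangentSpace 𝓘(ℝ, E) (γ t)) :
      (e ⟨γ t, v + w⟩).2 = (e ⟨γ t, v⟩).2 + (e ⟨γ t, w⟩).2 := trivializationAt_add htb v w
    have hsmul (c : ℝ) (v : TangentSpace 𝓘(ℝ, E) (γ t)) :
      (e ⟨γ t, c • v⟩).2 = c • (e ⟨γ t, v⟩).2 := trivializationAt_smul htb c v
    rw [trivializationAt_sum htb]
    simp only [← he, hadd, hsmul, (hgood t (hsub ht)).1]
    have h3 (i) : (e ⟨γ t, e.symm (γ t) (b i)⟩).2 = b i := by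
      rw [Trivialization.apply_mk_symm _ htb]
    simp only [h3]
    rw [Finset.sum_add_distrib, b.sum_repr, hAapply]
    exact neg_add_cancel _
  have h4 := Trivialization.symm_proj_apply e ⟨γ t, ∑ i, (b.repr (A t (v t)) i • σ i (γ t) +
      b.repr (v t) i • D (σ i) (γ t) (U (γ t)))⟩ htb
  rw [hzero] at h4
  simp only [← e.symmL_apply (R := ℝ) htb, map_zero] at h4
  exact h4

end ParallelExistence

/-! ### Compatible connections are metric and make `β♯` parallel -/

section Converse

variable [RiemannianBundle (fun x : M ↦ TangentSpace 𝓘(ℝ, E) x)]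
  [IsContMDiffRiemannianBundle 𝓘(ℝ, E) ∞ E (fun x : M ↦ TangentSpace 𝓘(ℝ, E) x)]
  {β : Π x : M, TangentSpace 𝓘(ℝ, E) x →L[ℝ] ℝ}

omit [FiniteDimensional ℝ E] [T2Space M]
  [RiemannianBundle (fun x : M ↦ TangentSpace 𝓘(ℝ, E) x)]
  [IsContMDiffRiemannianBundle 𝓘(ℝ, E) ∞ E (fun x : M ↦ TangentSpace 𝓘(ℝ, E) x)] in
theorem IsParallelAlong.neg {D : Connection E M} {γ : ℝ → M} {a b : ℝ}
    {V : Π r : ℝ, TangentSpace 𝓘(ℝ, E) (γ r)} (hγ : ∀ t ∈ Icc a b, MDiffAt[Icc a b] γ t)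
    (hV : IsParallelAlong D γ a b V) : IsParallelAlong D γ a b (fun r ↦ -V r) := by
  rw [isParallelAlong_iff] at hV ⊢
  intro t ht
  have := HasCovDerivWithinAt.smul (hγ t ht) (hasDerivWithinAt_const t (Icc a b) (-1 : ℝ)) (hV t ht)
  simpa using this

omit [T2Space M]
  [IsContMDiffRiemannianBundle 𝓘(ℝ, E) ∞ E (fun x : M ↦ TangentSpace 𝓘(ℝ, E) x)] in
/-- Preservation of the Randers norm by a linear map means preservation of the metric and of the
one-form. -/
theorem inner_eq_of_randersNorm_eq {x y : M} {v : TangentSpace 𝓘(ℝ, E) x}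
    {w : TangentSpace 𝓘(ℝ, E) y} (h : randersNorm β y w = randersNorm β x v)
    (h' : randersNorm β y (-w) = randersNorm β x (-v)) :
    (inner ℝ w w : ℝ) = inner ℝ v v ∧ (inner ℝ (sharp β y) w : ℝ) = inner ℝ (sharp β x) v := by
  -- Adding and subtracting the two equations separates the even part of the norm from the odd part.
  simp only [randersNorm_eq, inner_neg_left, inner_neg_right, neg_neg] at h h'
  refine ⟨?_, by linarith⟩
  have h1 : √(inner ℝ w w : ℝ) = √(inner ℝ v v : ℝ) := by linarith
  rwa [Real.sqrt_inj real_inner_self_nonneg real_inner_self_nonneg] at h1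

theorem hasDerivWithinAt_eq_zero_of_const {f : ℝ → ℝ} {δ c : ℝ} (hδ : 0 < δ)
    (hf : ∀ b ∈ Ioc 0 δ, f b = f 0) (h : HasDerivWithinAt f c (Icc 0 δ) 0) : c = 0 := by
  have h0 : (0 : ℝ) ∈ Icc 0 δ := ⟨le_rfl, hδ.le⟩
  have h1 : HasDerivWithinAt f 0 (Icc 0 δ) 0 := by
    refine (hasDerivWithinAt_const (0 : ℝ) (Icc 0 δ) (f 0)).congr (fun b hb ↦ ?_) rfl
    rcases hb.1.eq_or_lt with rfl | hb'
    · rfl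
    · exact hf b ⟨hb', hb.2⟩
  exact (uniqueDiffOn_Icc hδ 0 h0).eq_deriv _ h h1

omit [T2Space M] in
theorem derivMetricTensor_symm (D : Connection E M) (x : M) (u v w : TangentSpace 𝓘(ℝ, E) x) :
    CovariantDerivative.derivMetricTensor D x v w u =
      CovariantDerivative.derivMetricTensor D x w v u := by
  simp only [CovariantDerivative.derivMetricTensor_apply_eq_extend]
  rw [real_inner_comm v, real_inner_comm w]
  simp only [real_inner_comm (extend E w _) (extend E v _)]
  ring

/-- Take a parallel field starting at `v` along a curve with velocity `u`, and differentiate the two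
preserved quantities `⟨V, V⟩` and `⟨β♯, V⟩` at time zero. -/
theorem IsCompatible.deriv_eq_zero {D : Connection E M} (hβ : IsRandersMetric β)
    (hD : IsCompatible β D) (x : M) (u v : TangentSpace 𝓘(ℝ, E) x) :
    CovariantDerivative.derivMetricTensor D x v v u = 0 ∧
      (inner ℝ (D (sharp β) x u) v : ℝ) +
        CovariantDerivative.derivMetricTensor D x (sharp β x) v u = 0 := by
  obtain ⟨γ, rfl, ε, hε, hγ, hu, hpar⟩ := exists_parallel hD.smooth x u
  obtain ⟨δ, hδ, V, rfl, hV⟩ := hpar v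
  have hγ' : ∀ b ∈ Ioc 0 δ, ContMDiffOn 𝓘(ℝ, ℝ) 𝓘(ℝ, E) ∞ γ (Icc 0 b) := fun b hb ↦
    hγ.mono (Icc_subset_Icc_right (hb.2.trans hδ.2))
  have hγd : ∀ b ∈ Ioc 0 δ, ∀ t ∈ Icc 0 b, MDiffAt[Icc 0 b] γ t := fun b hb ↦
    (hγ' b hb).mdifferentiableOn (by simp)
  have hpres : ∀ b ∈ Ioc 0 δ, (inner ℝ (V b) (V b) : ℝ) = inner ℝ (V 0) (V 0) ∧
      (inner ℝ (sharp β (γ b)) (V b) : ℝ) = inner ℝ (sharp β (γ 0)) (V 0) := by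
    intro b hb
    refine inner_eq_of_randersNorm_eq ?_ ?_
    · exact hD.preserves γ 0 b hb.1.le (hγ' b hb) _ _ ⟨V, hV b hb, rfl, rfl⟩
    · exact hD.preserves γ 0 b hb.1.le (hγ' b hb) _ _
        ⟨fun r ↦ -V r, (hV b hb).neg (hγd b hb), rfl, rfl⟩
  have hδm : δ ∈ Ioc 0 δ := ⟨hδ.1, le_rfl⟩
  have h0 : (0 : ℝ) ∈ Icc 0 δ := ⟨le_rfl, hδ.1.le⟩
  have hu' : mfderivWithin 𝓘(ℝ, ℝ) 𝓘(ℝ, E) γ (Icc 0 δ) 0 (1 : ℝ) = u := hu δ hδ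
  have hc := isParallelAlong_iff.1 (hV δ hδm) 0 h0
  have hB := hasCovDerivWithinAt_field (D := D) (hγd δ hδm 0 h0)
    ((isSmoothField_sharp hβ).mdiffAt (γ 0))
  constructor
  · have := hasDerivWithinAt_eq_zero_of_const (f := fun r ↦ inner ℝ (V r) (V r)) hδ.1
      (fun b hb ↦ (hpres b hb).1) (HasCovDerivWithinAt.inner (hγd δ hδm 0 h0) hc hc)
    simpa [hu'] using this
  · have := hasDerivWithinAt_eq_zero_of_const (f := fun r ↦ inner ℝ (sharp β (γ r)) (V r)) hδ.1
      (fun b hb ↦ (hpres b hb).2) (HasCovDerivWithinAt.inner (hγd δ hδm 0 h0) hB hc)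
    simpa [hu'] using this

/-- Polarization of the diagonal case. -/
theorem IsCompatible.isMetric {D : Connection E M} (hβ : IsRandersMetric β)
    (hD : IsCompatible β D) : IsMetric D := by
  intro x u v w
  have h := (hD.deriv_eq_zero hβ x u (v + w)).1
  have hv := (hD.deriv_eq_zero hβ x u v).1
  have hw := (hD.deriv_eq_zero hβ x u w).1
  have hs := derivMetricTensor_symm D x u v w
  have hadd (z : TangentSpace 𝓘(ℝ, E) x) :
      CovariantDerivative.derivMetricTensor D x z (v + w) u =
        CovariantDerivative.derivMetricTensor D x z v u +
        CovariantDerivative.derivMetricTensor D x z w u := by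
    rw [ContinuousLinearMap.map_add, add_apply]
  rw [hadd, derivMetricTensor_symm D x u (v + w) v, derivMetricTensor_symm D x u (v + w) w, hadd,
    hadd] at h
  linarith

theorem IsCompatible.sharp_parallel {D : Connection E M} (hβ : IsRandersMetric β)
    (hD : IsCompatible β D) (x : M) : D (sharp β) x = 0 := by
  ext u
  refine ext_inner_right ℝ fun v ↦ ?_
  have h := (hD.deriv_eq_zero hβ x u v).2
  rw [hD.isMetric hβ x u, add_zero] at h
  simpa using h

end Converse

end Randers

end

/-! ### Local constancy, and differences of connections -/

noncomputable section

namespace Randers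

open Filter Topology Module FiberBundle

variable {E : Type*} [NormedAddCommGroup E] [NormedSpace ℝ E]
  {M : Type*} [TopologicalSpace M] [ChartedSpace E M] [IsManifold 𝓘(ℝ, E) ∞ M]

theorem isLocallyConstant_of_mvfderiv_eq_zero {f : M → ℝ} (hf : ∀ x, MDiffAt f x)
    (h : ∀ x, mvfderiv 𝓘(ℝ, E) f x = 0) : IsLocallyConstant f := by
  rw [IsLocallyConstant.iff_eventually_eq]
  intro x
  set φ := extChartAt 𝓘(ℝ, E) x with hφ
  obtain ⟨r, hr, hball⟩ := Metric.isOpen_iff.1 (isOpen_extChartAt_target (I := 𝓘(ℝ, E)) x) (φ x)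
    (mem_extChartAt_target x)
  have hderiv : ∀ z ∈ Metric.ball (φ x) r, HasFDerivAt (f ∘ φ.symm) (0 : E →L[ℝ] ℝ) z := by
    intro z hz
    have h1 : MDifferentiableAt 𝓘(ℝ, E) 𝓘(ℝ, E) φ.symm z :=
      ((contMDiffOn_extChartAt_symm (n := ∞) x).contMDiffAt
        ((isOpen_extChartAt_target x).mem_nhds (hball hz))).mdifferentiableAt (by simp)
    have h2 : HasMFDerivAt 𝓘(ℝ, E) 𝓘(ℝ) f (φ.symm z) 0 := by
      have h3 : mfderiv 𝓘(ℝ, E) 𝓘(ℝ) f (φ.symm z) = 0 := by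
        ext v
        exact congr($(h (φ.symm z)) v)
      rw [← h3]
      exact (hf _).hasMFDerivAt
    have h4 := h2.comp z h1.hasMFDerivAt
    rw [ContinuousLinearMap.zero_comp] at h4
    exact hasMFDerivAt_iff_hasFDerivAt.1 h4
  have hconst : ∀ z ∈ Metric.ball (φ x) r, (f ∘ φ.symm) z = (f ∘ φ.symm) (φ x) := by
    intro z hz
    refine Metric.isOpen_ball.is_const_of_fderiv_eq_zero (𝕜 := ℝ) (convex_ball _ _).isPreconnected
      (fun y hy ↦ (hderiv y hy).differentiableAt.differentiableWithinAt)
      (fun y hy ↦ (hderiv y hy).fderiv) hz (Metric.mem_ball_self hr)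
  have hev : ∀ᶠ y in 𝓝 x, φ y ∈ Metric.ball (φ x) r :=
    (continuousAt_extChartAt x).eventually (Metric.ball_mem_nhds _ hr)
  filter_upwards [hev, extChartAt_source_mem_nhds (I := 𝓘(ℝ, E)) x] with y hy hys
  have h1 := hconst _ hy
  simp only [Function.comp_apply] at h1
  rwa [φ.left_inv hys, φ.left_inv (mem_extChartAt_source x)] at h1

variable [FiniteDimensional ℝ E]

section Difference

/-- `D'` is obtained from `D` by adding the tensor `K`. -/
def IsSum (D : Connection E M)
    (K : Π x : M, TangentSpace 𝓘(ℝ, E) x →L[ℝ] TangentSpace 𝓘(ℝ, E) x →L[ℝ] TangentSpace 𝓘(ℝ, E) x)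
    (D' : Connection E M) : Prop :=
  ∀ (x : M) (Y : Π y : M, TangentSpace 𝓘(ℝ, E) y), MDiffAt (T% Y) x →
    ∀ u, D' Y x u = D Y x u + K x (Y x) u

theorem exists_isSum (D D' : Connection E M) : ∃ K, IsSum D K D' := by
  refine ⟨CovariantDerivative.difference D' D, fun x Y hY u ↦ ?_⟩
  have h := IsCovariantDerivativeOn.difference_apply D'.isCovariantDerivativeOnUniv
    D.isCovariantDerivativeOnUniv (mem_univ x) hY
  have h' : CovariantDerivative.difference D' D x (Y x) = D' Y x - D Y x := h
  rw [h', sub_apply]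
  abel

omit [FiniteDimensional ℝ E] in
theorem isSum_addOneForm (D : Connection E M)
    (K : Π x : M, TangentSpace 𝓘(ℝ, E) x →L[ℝ] TangentSpace 𝓘(ℝ, E) x →L[ℝ]
      TangentSpace 𝓘(ℝ, E) x) : IsSum D K (D.addOneForm K) :=
  fun _ _ _ _ ↦ rfl

variable {D D' : Connection E M}
  {K : Π x : M, TangentSpace 𝓘(ℝ, E) x →L[ℝ] TangentSpace 𝓘(ℝ, E) x →L[ℝ] TangentSpace 𝓘(ℝ, E) x}

/-- The first slot of `K` holds the differentiated vector and the second the direction, whence the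
order of the two terms. -/
theorem IsSum.torsion (h : IsSum D K D') (x : M) (u v : TangentSpace 𝓘(ℝ, E) x) :
    D'.torsion x u v = D.torsion x u v + (K x v u - K x u v) := by
  simp only [CovariantDerivative.torsion_apply_eq_extend]
  rw [h x _ (mdifferentiableAt_extend ..), h x _ (mdifferentiableAt_extend ..)]
  simp only [extend_apply_self]
  abel

theorem IsSum.smooth [T2Space M] (h : IsSum D K D')
    (hD : CovariantDerivative.ContMDiffCovariantDerivative D ∞)
    (hK : ∀ X Y : Π x : M, TangentSpace 𝓘(ℝ, E) x, IsSmoothField X → IsSmoothField Y →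
      IsSmoothField (fun x ↦ K x (Y x) (X x))) :
    CovariantDerivative.ContMDiffCovariantDerivative D' ∞ := by
  refine ⟨⟨fun {Y} hY ↦ ?_⟩⟩
  have hY' : IsSmoothField Y := by simpa [contMDiffOn_univ] using hY
  refine contMDiffOn_univ.2 (contMDiff_hom_of_forall_apply fun X hX ↦ ?_)
  have h1 : (fun x ↦ D' Y x (X x)) = (fun x ↦ D Y x (X x)) + fun x ↦ K x (Y x) (X x) := by
    ext x
    exact h x Y (hY'.mdiffAt x) _
  rw [h1]
  exact (isSmoothField_covariantDerivative hD hX hY').add_section (hK X Y hX hY')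

theorem isSmoothField_torsion (hD : CovariantDerivative.ContMDiffCovariantDerivative D ∞)
    {X Y : Π x : M, TangentSpace 𝓘(ℝ, E) x} (hX : IsSmoothField X) (hY : IsSmoothField Y) :
    IsSmoothField (fun x ↦ D.torsion x (X x) (Y x)) := by
  have h1 : (fun x ↦ D.torsion x (X x) (Y x)) =
      ((fun x ↦ D Y x (X x)) - fun x ↦ D X x (Y x)) - VectorField.mlieBracket 𝓘(ℝ, E) X Y := by
    ext x
    exact CovariantDerivative.torsion_apply D (hX.mdiffAt x) (hY.mdiffAt x)
  rw [h1]
  refine ((isSmoothField_covariantDerivative hD hX hY).sub_section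
    (isSmoothField_covariantDerivative hD hY hX)).sub_section fun x ↦ ?_
  have : IsManifold 𝓘(ℝ, E) (minSmoothness ℝ 2) M := by
    rw [minSmoothness_of_isRCLikeNormedField]
    infer_instance
  have : IsManifold 𝓘(ℝ, E) (∞ + 1) M := inferInstanceAs (IsManifold 𝓘(ℝ, E) ∞ M)
  exact ContMDiffAt.mlieBracket_vectorField (m := ⊤) (n := ⊤) (hX x) (hY x) (by simp)

variable [RiemannianBundle (fun x : M ↦ TangentSpace 𝓘(ℝ, E) x)]
  [IsContMDiffRiemannianBundle 𝓘(ℝ, E) ∞ E (fun x : M ↦ TangentSpace 𝓘(ℝ, E) x)]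

theorem IsSum.derivMetricTensor (h : IsSum D K D') (x : M) (u v w : TangentSpace 𝓘(ℝ, E) x) :
    CovariantDerivative.derivMetricTensor D' x v w u =
      CovariantDerivative.derivMetricTensor D x v w u - inner ℝ (K x v u) w
        - inner ℝ v (K x w u) := by
  simp only [CovariantDerivative.derivMetricTensor_apply_eq_extend]
  rw [h x _ (mdifferentiableAt_extend ..), h x _ (mdifferentiableAt_extend ..)]
  simp only [extend_apply_self, inner_add_left, inner_add_right]
  ring

theorem IsMetric.mvfderiv_inner (hD : IsMetric D) {x : M} {Y Z : Π y : M, TangentSpace 𝓘(ℝ, E) y}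
    (hY : MDiffAt (T% Y) x) (hZ : MDiffAt (T% Z) x) (u : TangentSpace 𝓘(ℝ, E) x) :
    mvfderiv 𝓘(ℝ, E) (fun y ↦ inner ℝ (Y y) (Z y)) x u =
      inner ℝ (D Y x u) (Z x) + inner ℝ (Y x) (D Z x u) := by
  have h : ∀ U : Π y : M, TangentSpace 𝓘(ℝ, E) y,
      CovariantDerivative.derivMetricTensor D x (Y x) (Z x) (U x) =
        mvfderiv 𝓘(ℝ, E) (fun y ↦ (Inner.inner ℝ (Y y) (Z y) : ℝ)) x (U x)
          - Inner.inner ℝ (D Y x (U x)) (Z x) - Inner.inner ℝ (Y x) (D Z x (U x)) := by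
    intro U
    apply CovariantDerivative.derivMetricTensor_apply
    exacts [hY, hZ]
  specialize h (extend E u)
  simp only [extend_apply_self] at h
  rw [hD x u (Y x) (Z x)] at h
  linarith

variable {β : Π x : M, TangentSpace 𝓘(ℝ, E) x →L[ℝ] ℝ}

/-- A metric connection with `β♯` parallel makes `|β♯|²` locally constant, hence constant on the
connected `M`; one zero would force `β = 0`. -/
theorem sharp_ne_zero [T2Space M] [ConnectedSpace M] (hβ : IsRandersMetric β) (hβ0 : β ≠ 0)
    (hD : IsMetric D) (hB : ∀ x, D (sharp β) x = 0) (x : M) : sharp β x ≠ 0 := by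
  have hs := isSmoothField_sharp hβ
  have hconst : IsLocallyConstant fun x ↦ (inner ℝ (sharp β x) (sharp β x) : ℝ) := by
    refine isLocallyConstant_of_mvfderiv_eq_zero (E := E)
      (fun x ↦ (hs.inner hs).mdifferentiableAt (by simp)) fun x ↦ ?_
    ext u
    rw [hD.mvfderiv_inner (hs.mdiffAt x) (hs.mdiffAt x), hB]
    simp
  intro hx
  refine hβ0 (funext fun y ↦ ?_)
  have h1 := hconst.apply_eq_of_preconnectedSpace y x
  simp only [hx, inner_zero_left] at h1
  have h2 : sharp β y = 0 := inner_self_eq_zero.1 h1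
  ext v
  rw [← inner_sharp, h2]
  simp

end Difference

end Randers

end

noncomputable section

namespace Randers

open Filter Topology Module FiberBundle

/-! ### Linear algebra in a single tangent space -/

section Algebra

open scoped RealInnerProductSpace

variable {V : Type*} [NormedAddCommGroup V] [InnerProductSpace ℝ V]

/-- Riesz representation in the last slot. The arguments of `φ` are direction, differentiated
vector, test vector. -/
theorem exists_bilinear_of_trilinear [FiniteDimensional ℝ V] (φ : V → V → V → ℝ)
    (h₁ : ∀ v w, IsLinearMap ℝ fun u ↦ φ u v w) (h₂ : ∀ u w, IsLinearMap ℝ fun v ↦ φ u v w)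
    (h₃ : ∀ u v, IsLinearMap ℝ fun w ↦ φ u v w) :
    ∃ K : V →L[ℝ] V →L[ℝ] V, ∀ u v w, ⟪K v u, w⟫ = φ u v w := by
  have : CompleteSpace V := FiniteDimensional.complete ℝ V
  let f : V → V → V := fun v u ↦ (InnerProductSpace.toDual ℝ V).symm
    (LinearMap.toContinuousLinearMap (IsLinearMap.mk' _ (h₃ u v)))
  have hf : ∀ u v w, ⟪f v u, w⟫ = φ u v w := fun u v w ↦ by
    rw [InnerProductSpace.toDual_symm_apply]
    rfl
  let L : V →ₗ[ℝ] V →ₗ[ℝ] V := LinearMap.mk₂ ℝ f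
    (fun v v' u ↦ ext_inner_right ℝ fun w ↦ by
      simpa only [inner_add_left, hf] using (h₂ u w).map_add v v')
    (fun c v u ↦ ext_inner_right ℝ fun w ↦ by
      simpa only [real_inner_smul_left, hf, smul_eq_mul] using (h₂ u w).map_smul c v)
    (fun v u u' ↦ ext_inner_right ℝ fun w ↦ by
      simpa only [inner_add_left, hf] using (h₁ v w).map_add u u')
    (fun c v u ↦ ext_inner_right ℝ fun w ↦ by
      simpa only [real_inner_smul_left, hf, smul_eq_mul] using (h₁ v w).map_smul c u)
  exact ⟨L.toContinuousBilinearMap, fun u v w ↦ hf u v w⟩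

/-- The tensor to be added to a metric connection with torsion `T` to make it torsion-free. -/
theorem exists_contorsion [FiniteDimensional ℝ V] (T : V →L[ℝ] V →L[ℝ] V) :
    ∃ K : V →L[ℝ] V →L[ℝ] V,
      ∀ u v w, ⟪K v u, w⟫ = (1 / 2) * (-⟪T u v, w⟫ + ⟪T u w, v⟫ + ⟪T v w, u⟫) := by
  refine exists_bilinear_of_trilinear _ (fun v w ↦ ⟨?_, ?_⟩) (fun u w ↦ ⟨?_, ?_⟩)
    (fun u v ↦ ⟨?_, ?_⟩) <;>
  · intros
    simp only [map_add, map_smul, add_apply, smul_apply, inner_add_left, inner_add_right,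
      real_inner_smul_left, real_inner_smul_right, smul_eq_mul]
    ring

/-- A trilinear form symmetric in one pair of slots and skew in an overlapping pair equals its own
negative after six transpositions. -/
theorem eq_zero_of_symm_of_antisymm {K : V →L[ℝ] V →L[ℝ] V} (hs : ∀ u v, K v u = K u v)
    (ha : ∀ u v w, ⟪K v u, w⟫ = -⟪v, K w u⟫) (u v : V) : K v u = 0 := by
  refine ext_inner_right ℝ fun w ↦ ?_
  rw [inner_zero_left]
  have hf : ∀ u v w, ⟪K v u, w⟫ = -⟪K w u, v⟫ := fun u v w ↦ by rw [ha, real_inner_comm]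
  have h1 := hf u v w
  rw [hs u w, hf w u v, hs w v, hf v w u, hs v u] at h1
  linarith

/-- The part of the extremal tensor which measures the failure of integrability of the orthogonal
complement of `B`. -/
def twistForm (S : V →L[ℝ] V) (B u v w : V) : ℝ :=
  -(1 / (2 * ⟪B, B⟫)) * ⟪u, B⟫ * (⟪S v, w⟫ - ⟪S w, v⟫
    - (1 / ⟪B, B⟫) * (⟪v, B⟫ * ⟪S B, w⟫ - ⟪w, B⟫ * ⟪S B, v⟫))

/-- The difference of the extremal compatible connection and the Levi-Civita connection, where
`S` is the Levi-Civita derivative of `B`. -/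
def extremalForm (S : V →L[ℝ] V) (B u v w : V) : ℝ :=
  (1 / ⟪B, B⟫) * (⟪S u, v⟫ * ⟪B, w⟫ - ⟪v, B⟫ * ⟪S u, w⟫) + twistForm S B u v w

theorem exists_extremalTensor [FiniteDimensional ℝ V] (S : V →L[ℝ] V) (B : V) :
    ∃ K : V →L[ℝ] V →L[ℝ] V, ∀ u v w, ⟪K v u, w⟫ = extremalForm S B u v w := by
  refine exists_bilinear_of_trilinear _ (fun v w ↦ ⟨?_, ?_⟩) (fun u w ↦ ⟨?_, ?_⟩)
    (fun u v ↦ ⟨?_, ?_⟩) <;>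
  · intros
    simp only [extremalForm, twistForm, map_add, map_smul, inner_add_left, inner_add_right,
      real_inner_smul_left, real_inner_smul_right, smul_eq_mul]
    ring

variable {S : V →L[ℝ] V} {B : V}

theorem extremalForm_antisymm (u v w : V) : extremalForm S B u v w = -extremalForm S B u w v := by
  simp only [extremalForm, twistForm, real_inner_comm B]
  ring

/-- This is what makes `B` parallel after the correction: the added tensor cancels `S`. The twist
contributes nothing, as it sees only projections to `B^⊥`. -/
theorem extremalForm_left (hS : ∀ u, ⟪S u, B⟫ = 0) (hB : B ≠ 0) (u w : V) :
    extremalForm S B u B w = -⟪S u, w⟫ := by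
  have hk : ⟪B, B⟫ ≠ 0 := inner_self_ne_zero.2 hB
  simp only [extremalForm, twistForm, hS]
  field_simp
  ring

/-- The twist is chosen to remove the skew part of `S` here: the torsion tested against `B^⊥`
involves only the symmetric part, the key to orthogonality. -/
theorem extremalForm_sub (u v : V) {w : V} (hw : ⟪w, B⟫ = 0) :
    extremalForm S B u v w - extremalForm S B v u w =
      1 / (2 * ⟪B, B⟫) *
        (⟪u, B⟫ * (⟪S v, w⟫ + ⟪S w, v⟫) - ⟪v, B⟫ * (⟪S u, w⟫ + ⟪S w, u⟫)) := by
  have hw' : ⟪B, w⟫ = 0 := by rwa [real_inner_comm]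
  simp only [extremalForm, twistForm, hw, hw']
  ring

/-- The bracket in `twistForm` is the skew part of `S` evaluated on the projections of `v` and `w`
to `B^⊥`; the choice `u = B` isolates it. -/
theorem twistForm_eq_zero_iff (hS : ∀ u, ⟪S u, B⟫ = 0) (hB : B ≠ 0) :
    (∀ u v w, twistForm S B u v w = 0) ↔
      ∀ v w, ⟪v, B⟫ = 0 → ⟪w, B⟫ = 0 → ⟪S v, w⟫ = ⟪S w, v⟫ := by
  have hk : ⟪B, B⟫ ≠ 0 := inner_self_ne_zero.2 hB
  refine ⟨fun h v w hv hw ↦ ?_, fun h u v w ↦ ?_⟩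
  · have := h B v w
    simp only [twistForm, hv, hw, zero_mul, sub_zero, mul_zero] at this
    field_simp at this
    linarith
  · have key := h (v - (⟪v, B⟫ / ⟪B, B⟫) • B) (w - (⟪w, B⟫ / ⟪B, B⟫) • B)
      (by rw [inner_sub_left, real_inner_smul_left, div_mul_cancel₀ _ hk, sub_self])
      (by rw [inner_sub_left, real_inner_smul_left, div_mul_cancel₀ _ hk, sub_self])
    simp only [map_sub, map_smul, inner_sub_left, inner_sub_right, real_inner_smul_left,
      real_inner_smul_right, hS, mul_zero, sub_zero] at key
    have : ⟪S v, w⟫ - ⟪S w, v⟫ - (1 / ⟪B, B⟫) * (⟪v, B⟫ * ⟪S B, w⟫ - ⟪w, B⟫ * ⟪S B, v⟫) = 0 := by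
      linear_combination key
    rw [twistForm, this, mul_zero]

variable {ι : Type*} [Fintype ι] (b : OrthonormalBasis ι ℝ V)

/-- The trace of a symmetric operator times a skew one is zero: interchanging the two summation
indices changes the sign. -/
theorem sum_symm_apply_antisymm {L : V →L[ℝ] V} (hL : ∀ u v, ⟪L u, v⟫ = -⟪u, L v⟫) :
    ∑ i, (⟪S (b i), L (b i)⟫ + ⟪S (L (b i)), b i⟫) = 0 := by
  have h1 : ∀ i, (⟪S (b i), L (b i)⟫ + ⟪S (L (b i)), b i⟫) =
      ∑ j, ⟪b j, L (b i)⟫ * (⟪S (b i), b j⟫ + ⟪S (b j), b i⟫) := by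
    intro i
    conv_lhs => rw [← b.sum_repr' (L (b i))]
    simp only [map_sum, map_smul, inner_sum, sum_inner, real_inner_smul_left,
      real_inner_smul_right, mul_add, Finset.sum_add_distrib]
  have h2 : ∑ i, ∑ j, ⟪b j, L (b i)⟫ * (⟪S (b i), b j⟫ + ⟪S (b j), b i⟫) =
      -∑ i, ∑ j, ⟪b j, L (b i)⟫ * (⟪S (b i), b j⟫ + ⟪S (b j), b i⟫) := by
    conv_lhs => rw [Finset.sum_comm]
    simp only [← Finset.sum_neg_distrib]
    refine Finset.sum_congr rfl fun i _ ↦ Finset.sum_congr rfl fun j _ ↦ ?_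
    have := hL (b j) (b i)
    rw [real_inner_comm] at this
    rw [this]
    ring
  rw [Finset.sum_congr rfl fun i _ ↦ h1 i]
  linarith

/-- Pythagoras: the cross term vanishes. Since `C` takes values in `B^⊥`, only the components
computed in `extremalForm_sub` enter. -/
theorem sum_norm_torsion_sq {K C : V →L[ℝ] V →L[ℝ] V}
    (hK : ∀ u v w, ⟪K v u, w⟫ = extremalForm S B u v w)
    (hC : ∀ u v w, ⟪C v u, w⟫ = -⟪v, C w u⟫) (hCB : ∀ u, C B u = 0) :
    ∑ i, ∑ j, ‖(K (b j) (b i) - K (b i) (b j)) + (C (b j) (b i) - C (b i) (b j))‖ ^ 2 =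
      ∑ i, ∑ j, ‖K (b j) (b i) - K (b i) (b j)‖ ^ 2 +
      ∑ i, ∑ j, ‖C (b j) (b i) - C (b i) (b j)‖ ^ 2 := by
  have hCB' : ∀ u v, ⟪C v u, B⟫ = 0 := fun u v ↦ by rw [hC, hCB, inner_zero_right, neg_zero]
  have hmain : ∑ i, ∑ j, ⟪K (b j) (b i) - K (b i) (b j), C (b j) (b i)⟫ = 0 := by
    have h1 : ∀ i j, ⟪K (b j) (b i) - K (b i) (b j), C (b j) (b i)⟫ = 1 / (2 * ⟪B, B⟫) *
        (⟪b i, B⟫ * (⟪S (b j), C (b j) (b i)⟫ + ⟪S (C (b j) (b i)), b j⟫) -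
          ⟪b j, B⟫ * (⟪S (b i), C (b j) (b i)⟫ + ⟪S (C (b j) (b i)), b i⟫)) := fun i j ↦ by
      rw [inner_sub_left, hK, hK, extremalForm_sub _ _ (hCB' _ _)]
    -- Summation over `i` replaces `⟨b i, B⟩ b i` by `B`, leaving the trace of the symmetrised `S`
    -- against the skew operator `u ↦ C u B`.
    have h2 : ∑ i, ∑ j, ⟪b i, B⟫ * (⟪S (b j), C (b j) (b i)⟫ + ⟪S (C (b j) (b i)), b j⟫) = 0 := by
      rw [Finset.sum_comm]
      have h3 := sum_symm_apply_antisymm (S := S) b (L := C.flip B) (fun u v ↦ hC B u v)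
      rw [← h3]
      refine Finset.sum_congr rfl fun j _ ↦ ?_
      conv_rhs => rw [← b.sum_repr' B]
      simp only [ContinuousLinearMap.flip_apply, map_sum, map_smul, sum_apply, smul_apply, inner_sum, sum_inner,
        real_inner_smul_left, real_inner_smul_right, mul_add, Finset.sum_add_distrib]
    -- Here summation puts `B` into the first slot of `C`, where `C` vanishes.
    have h3 : ∀ i, ∑ j, ⟪b j, B⟫ * (⟪S (b i), C (b j) (b i)⟫ + ⟪S (C (b j) (b i)), b i⟫) = 0 := by
      intro i
      have h4 : (⟪S (b i), C B (b i)⟫ + ⟪S (C B (b i)), b i⟫) = 0 := by simp [hCB]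
      rw [← h4]
      conv_rhs => rw [← b.sum_repr' B]
      simp only [map_sum, map_smul, sum_apply, smul_apply, inner_sum, sum_inner,
        real_inner_smul_left, real_inner_smul_right, mul_add, Finset.sum_add_distrib]
    calc _ = ∑ i, ∑ j, 1 / (2 * ⟪B, B⟫) *
        (⟪b i, B⟫ * (⟪S (b j), C (b j) (b i)⟫ + ⟪S (C (b j) (b i)), b j⟫) -
          ⟪b j, B⟫ * (⟪S (b i), C (b j) (b i)⟫ + ⟪S (C (b j) (b i)), b i⟫)) :=
          Finset.sum_congr rfl fun i _ ↦ Finset.sum_congr rfl fun j _ ↦ h1 i j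
      _ = 1 / (2 * ⟪B, B⟫) *
          (∑ i, ∑ j, ⟪b i, B⟫ * (⟪S (b j), C (b j) (b i)⟫ + ⟪S (C (b j) (b i)), b j⟫) -
            ∑ i, ∑ j, ⟪b j, B⟫ * (⟪S (b i), C (b j) (b i)⟫ + ⟪S (C (b j) (b i)), b i⟫)) := by
          simp only [← Finset.sum_sub_distrib, Finset.mul_sum]
      _ = 0 := by rw [h2, Finset.sum_congr rfl fun i _ ↦ h3 i]; simp
  -- The torsion of `K` is skew in `i, j`, so the second half of the torsion of `C` contributes the
  -- same zero sum up to sign.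
  have hcross : ∑ i, ∑ j, ⟪K (b j) (b i) - K (b i) (b j), C (b j) (b i) - C (b i) (b j)⟫ = 0 := by
    have h5 : ∑ i, ∑ j, ⟪K (b j) (b i) - K (b i) (b j), C (b i) (b j)⟫ = 0 := by
      rw [Finset.sum_comm, ← neg_eq_zero, ← hmain]
      simp only [← Finset.sum_neg_distrib, ← inner_neg_left, neg_sub]
    simp only [inner_sub_right _ (C _ _), Finset.sum_sub_distrib, hmain, h5, sub_zero]
  simp only [norm_add_sq_real, Finset.sum_add_distrib, ← Finset.mul_sum, hcross]
  ring

theorem eq_zero_of_sum_norm_sq_le_zero {C : V →L[ℝ] V →L[ℝ] V}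
    (hC : ∀ u v w, ⟪C v u, w⟫ = -⟪v, C w u⟫)
    (h : ∑ i, ∑ j, ‖C (b j) (b i) - C (b i) (b j)‖ ^ 2 ≤ 0) (u v : V) : C v u = 0 := by
  refine eq_zero_of_symm_of_antisymm (fun u v ↦ ?_) hC u v
  have h0 : ∀ i j, C (b j) (b i) = C (b i) (b j) := by
    have h1 := le_antisymm h (by positivity)
    intro i j
    rw [Finset.sum_eq_zero_iff_of_nonneg fun _ _ ↦ by positivity] at h1
    have h2 := h1 i (Finset.mem_univ i)
    rw [Finset.sum_eq_zero_iff_of_nonneg fun _ _ ↦ by positivity] at h2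
    exact sub_eq_zero.1 (norm_eq_zero.1 (pow_eq_zero_iff two_ne_zero |>.1 (h2 j (Finset.mem_univ j))))
  have h1 : C = C.flip := by
    refine ContinuousLinearMap.coe_injective (b.toBasis.ext fun i ↦ ?_)
    refine ContinuousLinearMap.coe_injective (b.toBasis.ext fun j ↦ ?_)
    simpa using h0 j i
  exact congr($h1 v u)

end Algebra

end Randers

end

noncomputable section

namespace Randers

open Filter Topology Module FiberBundle

variable {E : Type*} [NormedAddCommGroup E] [NormedSpace ℝ E] [FiniteDimensional ℝ E]
  {M : Type*} [TopologicalSpace M] [T2Space M] [ChartedSpace E M] [IsManifold 𝓘(ℝ, E) ∞ M]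
  [RiemannianBundle (fun x : M ↦ TangentSpace 𝓘(ℝ, E) x)]
  [IsContMDiffRiemannianBundle 𝓘(ℝ, E) ∞ E (fun x : M ↦ TangentSpace 𝓘(ℝ, E) x)]
  {β : Π x : M, TangentSpace 𝓘(ℝ, E) x →L[ℝ] ℝ} {D D' : Connection E M}
  {K : Π x : M, TangentSpace 𝓘(ℝ, E) x →L[ℝ] TangentSpace 𝓘(ℝ, E) x →L[ℝ] TangentSpace 𝓘(ℝ, E) x}

/-! ### Existence and uniqueness of the Levi-Civita connection -/

section LeviCivita

omit [T2Space M] in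
theorem IsLeviCivita.isMetric (h : IsLeviCivita D) : IsMetric D := by
  intro x u v w
  have h1 := congrFun h.isMetricCompatible x
  exact congr($h1 v w u)

omit [T2Space M] in
theorem isLeviCivita_of_isMetric (hs : CovariantDerivative.ContMDiffCovariantDerivative D ∞)
    (hm : IsMetric D) (ht : ∀ x u v, D.torsion x u v = 0) : IsLeviCivita D := by
  refine ⟨hs, ?_, ?_⟩
  · refine funext fun x ↦ ?_
    ext v w u
    exact hm x u v w
  · ext x u v
    exact ht x u v

omit [T2Space M] in
theorem IsSum.antisymm (h : IsSum D K D') (hD : IsMetric D) (hD' : IsMetric D') (x : M)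
    (u v w : TangentSpace 𝓘(ℝ, E) x) : inner ℝ (K x v u) w = -inner ℝ v (K x w u) := by
  have := h.derivMetricTensor x u v w
  rw [hD, hD'] at this
  linarith

omit [T2Space M] in
theorem IsSum.isMetric (h : IsSum D K D') (hD : IsMetric D)
    (hK : ∀ x u v w, inner ℝ (K x v u) w = -inner ℝ v (K x w u)) : IsMetric D' := by
  intro x u v w
  rw [h.derivMetricTensor, hD, hK]
  ring

omit [T2Space M] in
-- The difference tensor is symmetric by absence of torsion and skew by metricity, hence zero.
theorem IsLeviCivita.sameConnection (hD : IsLeviCivita D) (hD' : IsLeviCivita D') :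
    SameConnection D' D := by
  obtain ⟨K, hK⟩ := exists_isSum D D'
  intro x Y hY
  ext u
  have hs : ∀ u v, K x v u = K x u v := fun u v ↦ by
    have := hK.torsion x u v
    rw [hD.torsion_eq_zero, hD'.torsion_eq_zero] at this
    simp only [Pi.zero_apply, zero_apply, zero_add] at this
    exact sub_eq_zero.1 this.symm
  rw [hK x Y hY u, eq_zero_of_symm_of_antisymm hs (hK.antisymm hD.isMetric hD'.isMetric x),
    add_zero]

/-- Correcting a given metric connection by its contorsion keeps it metric and removes the torsion;
the compatible connection supplied by the Berwald hypothesis is the starting point. -/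
theorem exists_isLeviCivita (hs : CovariantDerivative.ContMDiffCovariantDerivative D ∞)
    (hm : IsMetric D) : ∃ D' : Connection E M, IsLeviCivita D' := by
  choose K hK using fun x : M ↦ exists_contorsion (D.torsion x)
  have ht : ∀ x u v, D.torsion x u v = -D.torsion x v u := fun x u v ↦
    CovariantDerivative.torsion_antisymm D u v
  have hsum := isSum_addOneForm D K
  refine ⟨D.addOneForm K, isLeviCivita_of_isMetric (hsum.smooth hs fun X Y hX hY ↦ ?_)
    (hsum.isMetric hm fun x u v w ↦ ?_) fun x u v ↦ ?_⟩
  · refine isSmoothField_of_forall_inner fun Z hZ ↦ ?_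
    simp only [hK]
    exact contMDiff_const.mul
      ((((isSmoothField_torsion hs hX hY).inner hZ).neg.add
        ((isSmoothField_torsion hs hX hZ).inner hY)).add
        ((isSmoothField_torsion hs hY hZ).inner hX))
  · rw [real_inner_comm, real_inner_comm, hK, real_inner_comm _ v, hK, ht x w v, inner_neg_left]
    ring
  · rw [hsum.torsion]
    refine ext_inner_right ℝ fun w ↦ ?_
    rw [inner_add_left, inner_sub_left, hK, hK, ht x v u, inner_neg_left, inner_zero_left]
    ring

end LeviCivita

end Randers

end

noncomputable section

namespace Randers

open Filter Topology Module FiberBundle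

variable {E : Type*} [NormedAddCommGroup E] [NormedSpace ℝ E] [FiniteDimensional ℝ E]
  {M : Type*} [TopologicalSpace M] [T2Space M] [ChartedSpace E M] [IsManifold 𝓘(ℝ, E) ∞ M]
  [RiemannianBundle (fun x : M ↦ TangentSpace 𝓘(ℝ, E) x)]
  [IsContMDiffRiemannianBundle 𝓘(ℝ, E) ∞ E (fun x : M ↦ TangentSpace 𝓘(ℝ, E) x)]
  {β : Π x : M, TangentSpace 𝓘(ℝ, E) x →L[ℝ] ℝ} {D D' Dstar : Connection E M}
  {K : Π x : M, TangentSpace 𝓘(ℝ, E) x →L[ℝ] TangentSpace 𝓘(ℝ, E) x →L[ℝ] TangentSpace 𝓘(ℝ, E) x}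

/-! ### The extremal compatible connection -/

section Extremal

/-- `K` is the difference of the extremal compatible connection and the Levi-Civita connection
`Dstar`. -/
def IsExtremalTensor (β : Π x : M, TangentSpace 𝓘(ℝ, E) x →L[ℝ] ℝ) (Dstar : Connection E M)
    (K : Π x : M, TangentSpace 𝓘(ℝ, E) x →L[ℝ] TangentSpace 𝓘(ℝ, E) x →L[ℝ]
      TangentSpace 𝓘(ℝ, E) x) : Prop :=
  ∀ x u v w, (inner ℝ (K x v u) w : ℝ) =
    extremalForm (V := TangentSpace 𝓘(ℝ, E) x) (Dstar (sharp β) x) (sharp β x) u v w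

omit [T2Space M] [IsContMDiffRiemannianBundle 𝓘(ℝ, E) ∞ E
  (fun x : M ↦ TangentSpace 𝓘(ℝ, E) x)] in
theorem exists_isExtremalTensor (β : Π x : M, TangentSpace 𝓘(ℝ, E) x →L[ℝ] ℝ)
    (Dstar : Connection E M) : ∃ K, IsExtremalTensor β Dstar K := by
  choose K hK using fun x : M ↦
    exists_extremalTensor (V := TangentSpace 𝓘(ℝ, E) x) (Dstar (sharp β) x) (sharp β x)
  exact ⟨K, hK⟩

/-- Compute the derivative of `|β♯|²` with both metric connections: it is zero by `D`, and twice
this inner product by `D'`. -/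
theorem IsMetric.inner_sharp_eq_zero (hβ : IsRandersMetric β) (hD : IsMetric D)
    (hB : ∀ x, D (sharp β) x = 0) (hD' : IsMetric D') (x : M) (u : TangentSpace 𝓘(ℝ, E) x) :
    inner ℝ (D' (sharp β) x u) (sharp β x) = 0 := by
  have hs := (isSmoothField_sharp hβ).mdiffAt x
  have h1 := hD.mvfderiv_inner hs hs u
  rw [hD'.mvfderiv_inner hs hs u, hB, real_inner_comm (D' (sharp β) x u) (sharp β x)] at h1
  simp only [zero_apply, inner_zero_left, inner_zero_right] at h1
  linarith

/-- The lowered form is rational in inner products of smooth fields, with only the nowhere zero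
`|β♯|²` in denominators. -/
theorem IsExtremalTensor.isSmoothField (hK : IsExtremalTensor β Dstar K) (hβ : IsRandersMetric β)
    (hD : CovariantDerivative.ContMDiffCovariantDerivative Dstar ∞) (h0 : ∀ x, sharp β x ≠ 0)
    {X Y : Π x : M, TangentSpace 𝓘(ℝ, E) x} (hX : IsSmoothField X) (hY : IsSmoothField Y) :
    IsSmoothField (fun x ↦ K x (Y x) (X x)) := by
  have hB := isSmoothField_sharp hβ
  have hS : ∀ {Z : Π x : M, TangentSpace 𝓘(ℝ, E) x}, IsSmoothField Z →
      IsSmoothField fun x ↦ Dstar (sharp β) x (Z x) :=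
    fun hZ ↦ isSmoothField_covariantDerivative hD hZ hB
  have hinv : ∀ {f : M → ℝ}, ContMDiff 𝓘(ℝ, E) 𝓘(ℝ, ℝ) ∞ f → (∀ x, f x ≠ 0) →
      ContMDiff 𝓘(ℝ, E) 𝓘(ℝ, ℝ) ∞ fun x ↦ 1 / f x := fun hf hf0 ↦ by
    simp only [one_div]
    exact hf.inv₀ hf0
  have hk := hB.inner hB
  have hk0 : ∀ x, (Inner.inner ℝ (sharp β x) (sharp β x) : ℝ) ≠ 0 :=
    fun x ↦ inner_self_ne_zero.2 (h0 x)
  refine isSmoothField_of_forall_inner fun Z hZ ↦ ?_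
  simp only [hK _ _ _ _, extremalForm, twistForm]
  refine (((hinv hk hk0).mul (((hS hX).inner hY).mul (hB.inner hZ) |>.sub
    ((hY.inner hB).mul ((hS hX).inner hZ))))).add ?_
  refine (((hinv (contMDiff_const.mul hk) fun x ↦ mul_ne_zero two_ne_zero (hk0 x)).neg.mul
    (hX.inner hB)).mul ?_)
  exact (((hS hY).inner hZ).sub ((hS hZ).inner hY)).sub ((hinv hk hk0).mul
    (((hY.inner hB).mul ((hS hB).inner hZ)).sub ((hZ.inner hB).mul ((hS hB).inner hY))))

theorem IsExtremalTensor.isCompatible (hK : IsExtremalTensor β Dstar K) (hβ : IsRandersMetric β)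
    (hD : IsLeviCivita Dstar) (h0 : ∀ x, sharp β x ≠ 0)
    (hS : ∀ x u, inner ℝ (Dstar (sharp β) x u) (sharp β x) = 0) :
    IsCompatible β (Dstar.addOneForm K) := by
  have hsum := isSum_addOneForm Dstar K
  refine isCompatible_of_isMetricCompatible hβ
    (hsum.smooth hD.smooth fun X Y hX hY ↦ hK.isSmoothField hβ hD.smooth h0 hX hY)
    (hsum.isMetric hD.isMetric fun x u v w ↦ ?_) fun x ↦ ?_
  · rw [hK x, real_inner_comm, hK x, extremalForm_antisymm]
  · ext u
    refine ext_inner_right ℝ fun w ↦ ?_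
    rw [hsum x _ ((isSmoothField_sharp hβ).mdiffAt x), inner_add_left, hK x,
      extremalForm_left (hS x) (h0 x)]
    simp

/-- The excess is the squared torsion of `C`, which yields both minimality and uniqueness. `C` kills
`β♯` because both connections make it parallel. -/
theorem torsionNormSq_eq_add (hK : IsExtremalTensor β Dstar K) (hβ : IsRandersMetric β)
    (hD : IsLeviCivita Dstar)
    (hc : IsCompatible β D) (hsum : IsSum Dstar K D) (hD' : IsCompatible β D')
    {C : Π x : M, TangentSpace 𝓘(ℝ, E) x →L[ℝ] TangentSpace 𝓘(ℝ, E) x →L[ℝ]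
      TangentSpace 𝓘(ℝ, E) x} (hC : IsSum D C D') (x : M) :
    torsionNormSq D' x = torsionNormSq D x +
      ∑ i, ∑ j, ‖C x (stdOrthonormalBasis ℝ (TangentSpace 𝓘(ℝ, E) x) j)
          (stdOrthonormalBasis ℝ (TangentSpace 𝓘(ℝ, E) x) i)
        - C x (stdOrthonormalBasis ℝ (TangentSpace 𝓘(ℝ, E) x) i)
          (stdOrthonormalBasis ℝ (TangentSpace 𝓘(ℝ, E) x) j)‖ ^ 2 := by
  have h1 : ∀ u v, D.torsion x u v = K x v u - K x u v := fun u v ↦ by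
    rw [hsum.torsion, hD.torsion_eq_zero]
    simp
  have hCB : ∀ u, C x (sharp β x) u = 0 := fun u ↦ by
    have := hC x _ ((isSmoothField_sharp hβ).mdiffAt x) u
    rw [hc.sharp_parallel hβ, hD'.sharp_parallel hβ] at this
    simpa using this.symm
  simp only [torsionNormSq, hC.torsion, h1]
  exact sum_norm_torsion_sq _ (hK x) (hC.antisymm (hc.isMetric hβ) (hD'.isMetric hβ) x) hCB

theorem IsExtremalTensor.isExtremal (hK : IsExtremalTensor β Dstar K) (hβ : IsRandersMetric β)
    (hD : IsLeviCivita Dstar) (hc : IsCompatible β D) (hsum : IsSum Dstar K D) :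
    IsExtremal β D := by
  refine ⟨hc, fun D' hD' x ↦ ?_⟩
  obtain ⟨C, hC⟩ := exists_isSum D D'
  rw [torsionNormSq_eq_add hK hβ hD hc hsum hD' hC x]
  exact le_add_of_nonneg_right (by positivity)

theorem IsExtremalTensor.sameConnection (hK : IsExtremalTensor β Dstar K)
    (hβ : IsRandersMetric β) (hD : IsLeviCivita Dstar) (hc : IsCompatible β D)
    (hsum : IsSum Dstar K D) (hD' : IsExtremal β D') : SameConnection D' D := by
  obtain ⟨C, hC⟩ := exists_isSum D D'
  intro x Y hY
  ext u
  have h1 := hD'.torsionNormSq_le D hc x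
  rw [torsionNormSq_eq_add hK hβ hD hc hsum hD'.isCompatible hC x, add_le_iff_nonpos_right] at h1
  rw [hC x Y hY u, eq_zero_of_sum_norm_sq_le_zero _
    (hC.antisymm (hc.isMetric hβ) (hD'.isCompatible.isMetric hβ) x) h1, add_zero]

end Extremal

/-! ### Integrability of `B^⊥` and comparison with `∇°` -/

section Integrable

/-- Without torsion the bracket is `∇_X Y - ∇_Y X`; differentiating `⟨Z, β♯⟩ = 0` moves each
derivative onto `β♯`. -/
theorem IsLeviCivita.inner_mlieBracket (hβ : IsRandersMetric β) (hD : IsLeviCivita D)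
    {X Y : Π x : M, TangentSpace 𝓘(ℝ, E) x} (hX : IsSmoothField X) (hY : IsSmoothField Y)
    (hXB : ∀ x, inner ℝ (X x) (sharp β x) = 0) (hYB : ∀ x, inner ℝ (Y x) (sharp β x) = 0)
    (x : M) : inner ℝ (VectorField.mlieBracket 𝓘(ℝ, E) X Y x) (sharp β x) =
      inner ℝ (D (sharp β) x (Y x)) (X x) - inner ℝ (D (sharp β) x (X x)) (Y x) := by
  have hB := (isSmoothField_sharp hβ).mdiffAt x
  have key : ∀ {Z : Π x : M, TangentSpace 𝓘(ℝ, E) x}, IsSmoothField Z →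
      (∀ x, (Inner.inner ℝ (Z x) (sharp β x) : ℝ) = 0) → ∀ u : TangentSpace 𝓘(ℝ, E) x,
      (Inner.inner ℝ (D Z x u) (sharp β x) : ℝ) = -Inner.inner ℝ (D (sharp β) x u) (Z x) := by
    intro Z hZ hZB u
    have h1 := hD.isMetric.mvfderiv_inner (hZ.mdiffAt x) hB u
    have h2 : (fun y ↦ (Inner.inner ℝ (Z y) (sharp β y) : ℝ)) = fun _ ↦ 0 := funext hZB
    rw [h2, mvfderiv_const] at h1
    rw [real_inner_comm (Z x)]
    simp only [zero_apply] at h1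
    linarith
  have ht := CovariantDerivative.torsion_apply D (hX.mdiffAt x) (hY.mdiffAt x)
  rw [hD.torsion_eq_zero] at ht
  have h3 : VectorField.mlieBracket 𝓘(ℝ, E) X Y x = D Y x (X x) - D X x (Y x) :=
    (sub_eq_zero.1 ht.symm).symm
  rw [h3, inner_sub_left, key hX hXB, key hY hYB]
  ring

/-- Extend arbitrarily and subtract the projection to `β♯`. This makes integrability, a condition on
global fields, a pointwise one. -/
theorem exists_isSmoothField_orthogonal (hβ : IsRandersMetric β) (h0 : ∀ x, sharp β x ≠ 0)
    {x : M} {v : TangentSpace 𝓘(ℝ, E) x} (hv : inner ℝ v (sharp β x) = 0) :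
    ∃ X : Π y : M, TangentSpace 𝓘(ℝ, E) y, IsSmoothField X ∧ X x = v ∧
      ∀ y, inner ℝ (X y) (sharp β y) = 0 := by
  obtain ⟨X, hX, rfl⟩ := exists_isSmoothField_eq v
  have hB := isSmoothField_sharp hβ
  have hk0 : ∀ x, (inner ℝ (sharp β x) (sharp β x) : ℝ) ≠ 0 :=
    fun x ↦ inner_self_ne_zero.2 (h0 x)
  let f : M → ℝ := fun y ↦ inner ℝ (X y) (sharp β y) / inner ℝ (sharp β y) (sharp β y)
  have hf : ContMDiff 𝓘(ℝ, E) 𝓘(ℝ, ℝ) ∞ f := (hX.inner hB).div₀ (hB.inner hB) hk0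
  refine ⟨fun y ↦ X y - f y • sharp β y, hX.sub_section (hf.smul_section hB), ?_, fun y ↦ ?_⟩
  · simp [f, hv]
  · rw [inner_sub_left, real_inner_smul_left, div_mul_cancel₀ _ (hk0 y), sub_self]

theorem orthogonalDistributionIntegrable_iff (hβ : IsRandersMetric β) (h0 : ∀ x, sharp β x ≠ 0)
    (hD : IsLeviCivita D) :
    OrthogonalDistributionIntegrable β ↔ ∀ (x : M) (v w : TangentSpace 𝓘(ℝ, E) x),
      inner ℝ v (sharp β x) = 0 → inner ℝ w (sharp β x) = 0 →
        (inner ℝ (D (sharp β) x v) w : ℝ) = inner ℝ (D (sharp β) x w) v := by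
  refine ⟨fun h x v w hv hw ↦ ?_, fun h X Y hX hY hXB hYB x ↦ ?_⟩
  · obtain ⟨X, hX, rfl, hXB⟩ := exists_isSmoothField_orthogonal hβ h0 hv
    obtain ⟨Y, hY, rfl, hYB⟩ := exists_isSmoothField_orthogonal hβ h0 hw
    have h1 := h X Y hX hY hXB hYB x
    rw [hD.inner_mlieBracket hβ hX hY hXB hYB] at h1
    linarith
  · rw [hD.inner_mlieBracket hβ hX hY hXB hYB, h x _ _ (hXB x) (hYB x), sub_self]

omit [T2Space M] [IsContMDiffRiemannianBundle 𝓘(ℝ, E) ∞ E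
  (fun x : M ↦ TangentSpace 𝓘(ℝ, E) x)] in
-- The extremal tensor is the `∇°` correction plus the twist, so the two connections differ by the
-- twist alone.
theorem IsExtremalTensor.sameConnection_nablaCirc_iff (hK : IsExtremalTensor β Dstar K)
    (hsum : IsSum Dstar K D) : SameConnection D (nablaCirc β Dstar) ↔
      ∀ (x : M) (u v w : TangentSpace 𝓘(ℝ, E) x),
        twistForm (V := TangentSpace 𝓘(ℝ, E) x) (Dstar (sharp β) x) (sharp β x) u v w = 0 := by
  have key : ∀ (x : M) (Y : Π y : M, TangentSpace 𝓘(ℝ, E) y), MDiffAt (T% Y) x →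
      ∀ u w : TangentSpace 𝓘(ℝ, E) x, (inner ℝ (D Y x u) w : ℝ) =
        inner ℝ (nablaCirc β Dstar Y x u) w +
          twistForm (V := TangentSpace 𝓘(ℝ, E) x) (Dstar (sharp β) x) (sharp β x) u (Y x) w := by
    intro x Y hY u w
    have h1 : nablaCirc β Dstar Y x u = Dstar Y x u + (‖sharp β x‖ ^ 2)⁻¹ •
      ((inner ℝ (Y x) (Dstar (sharp β) x u) : ℝ) • sharp β x
        - (inner ℝ (Y x) (sharp β x) : ℝ) • Dstar (sharp β) x u) := rfl
    rw [hsum x Y hY u, h1, inner_add_left, hK x, inner_add_left, real_inner_smul_left,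
      inner_sub_left, real_inner_smul_left, real_inner_smul_left, extremalForm,
      ← real_inner_self_eq_norm_sq, real_inner_comm (Y x), one_div]
    ring
  refine ⟨fun h x u v w ↦ ?_, fun h x Y hY ↦ ?_⟩
  · have h1 := key x (extend E v) (mdifferentiableAt_extend ..) u w
    rw [h x _ (mdifferentiableAt_extend ..), extend_apply_self] at h1
    linarith
  · ext u
    refine ext_inner_right ℝ fun w ↦ ?_
    rw [key x Y hY, h x, add_zero]

end Integrable

end Randers

end

theorem mainTheorem3
    {E : Type*} [NormedAddCommGroup E] [NormedSpace ℝ E] [FiniteDimensional ℝ E]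
    {M : Type*} [TopologicalSpace M] [T2Space M] [ConnectedSpace M]
    [ChartedSpace E M] [IsManifold 𝓘(ℝ, E) ∞ M]
    [RiemannianBundle (fun x : M ↦ TangentSpace 𝓘(ℝ, E) x)]
    [IsContMDiffRiemannianBundle 𝓘(ℝ, E) ∞ E (fun x : M ↦ TangentSpace 𝓘(ℝ, E) x)]
    (β : Π x : M, TangentSpace 𝓘(ℝ, E) x →L[ℝ] ℝ)
    (hβ : Randers.IsGeneralizedBerwald β) (hβ0 : β ≠ 0) :
    ∃ Dstar : Randers.Connection E M, Randers.IsLeviCivita Dstar ∧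
      (∀ D' : Randers.Connection E M, Randers.IsLeviCivita D' →
        Randers.SameConnection D' Dstar) ∧
      ∃ D : Randers.Connection E M, Randers.IsExtremal β D ∧
        (∀ D' : Randers.Connection E M, Randers.IsExtremal β D' →
          Randers.SameConnection D' D) ∧
        (Randers.SameConnection D (Randers.nablaCirc β Dstar) ↔
          Randers.OrthogonalDistributionIntegrable β) := by
  obtain ⟨hR, D₀, hD₀⟩ := hβ
  have hm := hD₀.isMetric hR
  have hB := hD₀.sharp_parallel hR
  have h0 := Randers.sharp_ne_zero hR hβ0 hm hB
  obtain ⟨Dstar, hstar⟩ := Randers.exists_isLeviCivita hD₀.smooth hm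
  have hS := hm.inner_sharp_eq_zero hR hB hstar.isMetric
  obtain ⟨K, hK⟩ := Randers.exists_isExtremalTensor β Dstar
  have hsum := Randers.isSum_addOneForm Dstar K
  have hc := hK.isCompatible hR hstar h0 hS
  refine ⟨Dstar, hstar, fun D' hD' ↦ hstar.sameConnection hD', Dstar.addOneForm K,
    hK.isExtremal hR hstar hc hsum, fun D' hD' ↦ hK.sameConnection hR hstar hc hsum hD', ?_⟩
  rw [hK.sameConnection_nablaCirc_iff hsum,
    Randers.orthogonalDistributionIntegrable_iff hR h0 hstar]
  exact forall_congr' fun x ↦ Randers.twistForm_eq_zero_iff (hS x) (h0 x)
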